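/- Theorem 2 (Wyner–Ziv with a common helper under $Y-X-Z$). Let $\mathcal X,\mathcal Y,\mathcal Z,\hat{\mathcal X}$ be finite alphabets, let $d:\mathcal X\times\hat{\mathcal X}\to[0,\infty)$ be a distortion measure, let $D\in\mathbb R$, and let $(X_i,Y_i,Z_i)$, $i=1,2,\dots$, be i.i.d. with law $p(x,y,z)$ on $\mathcal X\times\mathcal Y\times\mathcal Z$ such that $Y-X-Z$ is a Markov chain. Logarithms (in all information quantities) are to base $2$. An $(n,M_1,M)$ code consists of a helper map $f_1:\mathcal Y^n\to\{1,\dots,M_1\}$, an encoder $f:\mathcal X^n\times\{1,\dots,M_1\}\to\{1,\dots,M\}$ and a decoder $g:\mathcal Z^n\times\{1,\dots,M_1\}\times\{1,\dots,M\}\to\hat{\mathcal X}^n$. With $T_1=f_1(Y^n)$, $T=f(X^n,T_1)$ and $\hat X^n=g(Z^n,T_1,T)$, its distortion is $\mathbb E\big[\frac1n\sum_{i=1}^n d(X_i,\hat X_i)\big]$. A pair $(R,R_1)\in\mathbb R^2$ is achievable at distortion $D$ if for every $\epsilon>0$ and all sufficiently large $n$ there is an $(n,\lfloor 2^{nR_1}\rfloor,\lfloor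 2^{nR}\rfloor)$ code with distortion at most $D+\epsilon$. Let $\mathcal R^O_{Y-X-Z}(D)$ be the closure in $\mathbb R^2$ of the set of achievable pairs. Let $\mathcal R_{Y-X-Z}(D)$ be the set of all pairs $(R,R_1)$ such that $$R_1\ge I(U;Y|Z),\qquad R\ge I(X;W|U,Z)$$ for some random variables $U,W$ with finite alphabets $\mathcal U,\mathcal W$ whose joint law with $(X,Y,Z)$ has the form $$p(x,y,z,u,w)=p(x,y)\,p(z|x)\,p(u|y)\,p(w|x,u),$$ and some function $\hat X:\mathcal U\times\mathcal W\times\mathcal Z\to\hat{\mathcal X}$ with $\mathbb E\, d(X,\hat X(U,W,Z))\le D$. Then $$\mathcal R^O_{Y-X-Z}(D)=\mathcal R_{Y-X-Z}(D).$$ -/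

import Mathlib

namespace WynerZivHelper

open Filter

noncomputable section

section Information

variable {Ω α β γ : Type*} [Fintype Ω] [Fintype α] [Fintype β] [Fintype γ]

/-- The probability that the random variable `f` takes the value `b`, when the outcome is drawn
from the finite set `Ω` with probability mass function `q`. -/
def law (q : Ω → ℝ) (f : Ω → β) (b : β) : ℝ :=
  ∑ ω, (f ⁻¹' {b}).indicator q ω

/-- Conditional entropy in bits, `H(A|C) = -∑ p(a,c) log₂ p(a|c)`; a term with `p(a,c) = 0`
contributes `0`. -/
def condEntropy (q : Ω → ℝ) (A : Ω → α) (C : Ω → γ) : ℝ :=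
  -∑ a, ∑ c, law q (fun ω => (A ω, C ω)) (a, c) *
    Real.logb 2 (law q (fun ω => (A ω, C ω)) (a, c) / law q C c)

/-- Conditional mutual information in bits, `I(A;B|C) = H(A|C) - H(A|B,C)`. -/
def condMutualInfo (q : Ω → ℝ) (A : Ω → α) (B : Ω → β) (C : Ω → γ) : ℝ :=
  condEntropy q A C - condEntropy q A (fun ω => (B ω, C ω))

end Information

variable {X Y Z Xhat : Type*} [Fintype X] [Fintype Y] [Fintype Z]

/-- The Markov chain `Y - X - Z` for `(X,Y,Z) ∼ p`: `p(x,y,z) p(x) = p(x,y) p(x,z)`. -/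
def IsMarkovYXZ (p : X × Y × Z → ℝ) : Prop :=
  ∀ x y z, p (x, y, z) * law p (fun s => s.1) x =
    law p (fun s => (s.1, s.2.1)) (x, y) * law p (fun s => (s.1, s.2.2)) (x, z)

/-- A block code of length `n`. The helper sends one of `M₁` messages, seen by both the encoder
and the decoder; the encoder sends one of `M` messages to the decoder; the decoder moreover
observes the side information `zⁿ`. -/
structure Code (X Y Z Xhat : Type*) (n M₁ M : ℕ) where
  helper : (Fin n → Y) → Fin M₁
  encoder : (Fin n → X) → Fin M₁ → Fin M
  decoder : (Fin n → Z) → Fin M₁ → Fin M → (Fin n → Xhat)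

/-- The reconstruction `x̂ⁿ` that the code produces from the source realization
`s = (xᵢ, yᵢ, zᵢ)ᵢ`. -/
def Code.reconstruct {n M₁ M : ℕ} (c : Code X Y Z Xhat n M₁ M) (s : Fin n → X × Y × Z) :
    Fin n → Xhat :=
  let t₁ := c.helper (fun i => (s i).2.1)
  let t := c.encoder (fun i => (s i).1) t₁
  c.decoder (fun i => (s i).2.2) t₁ t

/-- The expected distortion `E[(1/n) ∑ᵢ d(Xᵢ, X̂ᵢ)]`, where the triples `(Xᵢ, Yᵢ, Zᵢ)` are
i.i.d. with law `p`. -/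
def Code.expectedDistortion {n M₁ M : ℕ} (c : Code X Y Z Xhat n M₁ M) (p : X × Y × Z → ℝ)
    (d : X → Xhat → ℝ) : ℝ :=
  ∑ s : Fin n → X × Y × Z,
    (∏ i, p (s i)) * ((1 / (n : ℝ)) * ∑ i, d (s i).1 (c.reconstruct s i))

/-- `(R, R₁)` is achievable at distortion `D`: for every `ε > 0` and all sufficiently large `n`
there is a code with `⌊2^(n R₁)⌋` helper messages, `⌊2^(n R)⌋` encoder messages and expected
distortion at most `D + ε`. -/
def Achievable (p : X × Y × Z → ℝ) (d : X → Xhat → ℝ) (D : ℝ) (r : ℝ × ℝ) : Prop :=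
  ∀ ε : ℝ, 0 < ε → ∀ᶠ n : ℕ in atTop,
    ∃ c : Code X Y Z Xhat n ⌊(2 : ℝ) ^ ((n : ℝ) * r.2)⌋₊ ⌊(2 : ℝ) ^ ((n : ℝ) * r.1)⌋₊,
      c.expectedDistortion p d ≤ D + ε

/-- The operational region: the closure of the set of achievable pairs `(R, R₁)`. -/
def operationalRegion (p : X × Y × Z → ℝ) (d : X → Xhat → ℝ) (D : ℝ) : Set (ℝ × ℝ) :=
  closure {r | Achievable p d D r}

/-- The joint law `p(x,y,z) p(u|y) p(w|x,u)` of `(X,Y,Z,U,W)`; under the Markov chain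
`Y - X - Z` the first factor is `p(x,y) p(z|x)`. -/
def jointLaw {U W : Type*} (p : X × Y × Z → ℝ) (pU : Y → U → ℝ) (pW : X → U → W → ℝ) :
    X × Y × Z × U × W → ℝ :=
  fun (x, y, z, u, w) => p (x, y, z) * pU y u * pW x u w

/-- The single-letter region: all `(R, R₁)` with `R₁ ≥ I(U;Y|Z)` and `R ≥ I(X;W|U,Z)` for some
auxiliary variables `U`, `W` with finite alphabets, with joint law `p(x,y,z) p(u|y) p(w|x,u)`, and
some reconstruction function `x̂(u,w,z)` with `E d(X, x̂(U,W,Z)) ≤ D`. -/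
def informationRegion (p : X × Y × Z → ℝ) (d : X → Xhat → ℝ) (D : ℝ) : Set (ℝ × ℝ) :=
  {r | ∃ (k l : ℕ) (pU : Y → Fin k → ℝ) (pW : X → Fin k → Fin l → ℝ)
      (xhat : Fin k → Fin l → Z → Xhat),
    (∀ y, pU y ∈ stdSimplex ℝ (Fin k)) ∧
    (∀ x u, pW x u ∈ stdSimplex ℝ (Fin l)) ∧
    condMutualInfo (jointLaw p pU pW)
      (fun (_, _, _, u, _) => u) (fun (_, y, _, _, _) => y) (fun (_, _, z, _, _) => z) ≤ r.2 ∧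
    condMutualInfo (jointLaw p pU pW)
      (fun (x, _, _, _, _) => x) (fun (_, _, _, _, w) => w) (fun (_, _, z, u, _) => (u, z))
        ≤ r.1 ∧
    ∑ x, ∑ y, ∑ z, ∑ u, ∑ w, jointLaw p pU pW (x, y, z, u, w) * d x (xhat u w z) ≤ D}

end

end WynerZivHelper

namespace WynerZivHelper

open Filter

noncomputable section

/-! ### Laws of random variables on a finite measure space. -/

section Law

variable {Ω α β γ : Type*} [Fintype Ω]

/-! Converse. Given a code, let `I` be a uniform time index, put U = (I, T₁, X^{I-1}, Z at all times
other than I) and W = T. Together with Z_I, U carries the whole block Zⁿ, so both rate bounds follow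
by telescoping entropies (`Code.sum_helper_le`, `Code.sum_encoder_le`). The source triple at time I
influences U only through Y_I, which gives U - Y - (X,Z). W need not be independent of Y given
(X,U), but the informations and the distortion depend only on the laws of (X,Y,Z,U) and (X,Z,U,W),
and Y - X - Z makes the latter factor as required (`mem_informationRegion_of_factorization`). This
places an achievable pair in the region at distortion D + ε. The limit ε → 0 and the closure are
absorbed by `isClosed_setOf_mem_informationRegion`: Carathéodory's theorem bounds the auxiliary
alphabets, and then the conditional laws range over a compact set on which the costs are continuous.

Achievability. The random code is a race of exponential clocks indexed by (codeword, bin). The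
helper runs the race with speeds p(u|y)/M₁ and sends the bin of the winner; encoder and decoder
rerun it inside that bin with speeds p(u|x) and p(u|z), on the same clocks. A second race does the
same for W. The probability of one index winning all these races has a closed-form lower bound
(`le_clocks_real_forall_wins`), so the error is controlled by the likelihood ratios p(u|y)/p(u|x),
p(u|y)/p(u|z), p(w|x,u)/p(w|u,z) divided by the numbers of bins (`exists_oneShot_code`). For i.i.d.
blocks exponential tilting sends these errors to zero once the rates exceed the mean log ratios
(`tendsto_sum_prod_mul_div`). Recovery of U at the encoder costs nothing extra: by Y - X - Z, H(U|X)
= H(U|X,Z) ≤ H(U|Z) (`sum_helper_density_x_le`). -/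

theorem law_eq_sum_ite [DecidableEq β] (q : Ω → ℝ) (f : Ω → β) (b : β) :
    law q f b = ∑ ω, if f ω = b then q ω else 0 := by
  unfold law
  refine Finset.sum_congr rfl fun ω _ => ?_
  by_cases h : f ω = b <;> simp [h]

theorem law_nonneg {q : Ω → ℝ} (hq : ∀ ω, 0 ≤ q ω) (f : Ω → β) (b : β) : 0 ≤ law q f b :=
  Finset.sum_nonneg fun _ _ => Set.indicator_nonneg (fun _ _ => hq _) _

/-- Expectation of a function of a random variable. -/
theorem sum_law_mul [Fintype β] (q : Ω → ℝ) (f : Ω → β) (g : β → ℝ) :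
    ∑ b, law q f b * g b = ∑ ω, q ω * g (f ω) := by
  classical
  simp_rw [law_eq_sum_ite, Finset.sum_mul]
  rw [Finset.sum_comm]
  refine Finset.sum_congr rfl fun ω _ => ?_
  simp [ite_mul]

theorem sum_law [Fintype β] (q : Ω → ℝ) (f : Ω → β) : ∑ b, law q f b = ∑ ω, q ω := by
  simpa using sum_law_mul q f (fun _ => 1)

theorem law_law [Fintype β] (q : Ω → ℝ) (f : Ω → β) (g : β → γ) :
    law (law q f) g = law q (fun ω => g (f ω)) := by
  classical
  funext c
  rw [law_eq_sum_ite, law_eq_sum_ite]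
  have := sum_law_mul q f (fun b => if g b = c then 1 else 0)
  simpa using this

theorem law_comp_eq_of_law_eq [Fintype β] {Ω' : Type*} [Fintype Ω'] {q : Ω → ℝ} {q' : Ω' → ℝ}
    {f : Ω → β} {f' : Ω' → β} (h : law q f = law q' f') (g : β → γ) :
    law q (fun ω => g (f ω)) = law q' (fun ω => g (f' ω)) := by
  rw [← law_law q f g, h, law_law]

theorem law_id (q : Ω → ℝ) (ω : Ω) : law q (fun ω => ω) ω = q ω := by
  classical
  rw [law_eq_sum_ite]; simp

/-- Marginalization of the first component. -/
theorem sum_law_fst [Fintype α] (q : Ω → ℝ) (A : Ω → α) (B : Ω → β) (b : β) :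
    ∑ a, law q (fun ω => (A ω, B ω)) (a, b) = law q B b := by
  classical
  simp_rw [law_eq_sum_ite, Prod.mk.injEq]
  rw [Finset.sum_comm]
  refine Finset.sum_congr rfl fun ω _ => ?_
  by_cases h : B ω = b <;> simp [h]

/-- Marginalization of the second component. -/
theorem sum_law_snd [Fintype β] (q : Ω → ℝ) (A : Ω → α) (B : Ω → β) (a : α) :
    ∑ b, law q (fun ω => (A ω, B ω)) (a, b) = law q A a := by
  classical
  simp_rw [law_eq_sum_ite, Prod.mk.injEq]
  rw [Finset.sum_comm]
  refine Finset.sum_congr rfl fun ω _ => ?_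
  by_cases h : A ω = a <;> simp [h]

theorem le_law_self {q : Ω → ℝ} (hq : ∀ ω, 0 ≤ q ω) (f : Ω → β) (ω : Ω) :
    q ω ≤ law q f (f ω) := by
  classical
  rw [law_eq_sum_ite]
  have := Finset.single_le_sum (f := fun ω' => if f ω' = f ω then q ω' else 0)
    (fun i _ => by split_ifs <;> simp [hq]) (Finset.mem_univ ω)
  simpa using this

theorem law_pos_of_pos {q : Ω → ℝ} (hq : ∀ ω, 0 ≤ q ω) (f : Ω → β) {ω : Ω} (h : 0 < q ω) :
    0 < law q f (f ω) :=
  h.trans_le (le_law_self hq f ω)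

/-- A coarser random variable has larger point probabilities. -/
theorem law_le_law_of_imp {q : Ω → ℝ} (hq : ∀ ω, 0 ≤ q ω) {A : Ω → α} {B : Ω → β}
    (h : ∀ ω ω', B ω = B ω' → A ω = A ω') (ω : Ω) :
    law q B (B ω) ≤ law q A (A ω) := by
  classical
  rw [law_eq_sum_ite, law_eq_sum_ite]
  refine Finset.sum_le_sum fun ω' _ => ?_
  by_cases hb : B ω' = B ω
  · simp [hb, h _ _ hb]
  · simp only [hb, if_false]
    split_ifs <;> simp [hq]

end Law

/-! ### Entropy inequalities. -/

section Entropy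

variable {Ω α β γ : Type*} [Fintype Ω] [Fintype α] [Fintype β] [Fintype γ]

/-- Entropy in bits of a random variable on a finite measure space. -/
def entropy (q : Ω → ℝ) (A : Ω → α) : ℝ :=
  -∑ a, law q A a * Real.logb 2 (law q A a)

theorem entropy_eq_sum (q : Ω → ℝ) (A : Ω → α) :
    entropy q A = -∑ ω, q ω * Real.logb 2 (law q A (A ω)) := by
  rw [entropy, sum_law_mul q A (fun a => Real.logb 2 (law q A a))]

theorem condEntropy_congr_law {Ω' : Type*} [Fintype Ω'] {q : Ω → ℝ} {q' : Ω' → ℝ} {A : Ω → α}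
    {A' : Ω' → α} {C : Ω → γ} {C' : Ω' → γ}
    (h : law q (fun ω => (A ω, C ω)) = law q' (fun ω => (A' ω, C' ω))) :
    condEntropy q A C = condEntropy q' A' C' := by
  rw [condEntropy, condEntropy, h]
  have : law q C = law q' C' := law_comp_eq_of_law_eq h Prod.snd
  rw [this]

theorem condEntropy_eq_sum (q : Ω → ℝ) (A : Ω → α) (C : Ω → γ) :
    condEntropy q A C = -∑ ω, q ω *
      Real.logb 2 (law q (fun ω => (A ω, C ω)) (A ω, C ω) / law q C (C ω)) := by
  rw [condEntropy, ← sum_law_mul q (fun ω => (A ω, C ω)) (fun v =>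
    Real.logb 2 (law q (fun ω => (A ω, C ω)) v / law q C v.2)), Fintype.sum_prod_type]

theorem condEntropy_eq {q : Ω → ℝ} (hq : ∀ ω, 0 ≤ q ω) (A : Ω → α) (C : Ω → γ) :
    condEntropy q A C = entropy q (fun ω => (A ω, C ω)) - entropy q C := by
  rw [condEntropy_eq_sum, entropy_eq_sum, entropy_eq_sum, sub_eq_add_neg, neg_neg, ← sub_eq_neg_add,
    ← Finset.sum_sub_distrib, ← Finset.sum_neg_distrib]
  refine Finset.sum_congr rfl fun ω _ => ?_
  rcases (hq ω).eq_or_lt with h | h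
  · simp [← h]
  · rw [Real.logb_div (law_pos_of_pos hq (fun ω => (A ω, C ω)) h).ne' (law_pos_of_pos hq C h).ne']
    ring

/-- Coarsening enlarges point probabilities and so lowers their negative logarithms. Comparing
partitions instead of naming a function turns later entropy identities into propositional checks. -/
theorem entropy_le_of_imp {q : Ω → ℝ} (hq : ∀ ω, 0 ≤ q ω) {A : Ω → α} {B : Ω → β}
    (h : ∀ ω ω', B ω = B ω' → A ω = A ω') : entropy q A ≤ entropy q B := by
  rw [entropy_eq_sum, entropy_eq_sum, neg_le_neg_iff]
  refine Finset.sum_le_sum fun ω _ => ?_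
  rcases (hq ω).eq_or_lt with h0 | h0
  · simp [← h0]
  · exact mul_le_mul_of_nonneg_left (Real.logb_le_logb_of_le one_lt_two
      (law_pos_of_pos hq B h0) (law_le_law_of_imp hq h ω)) h0.le

/-- Entropy depends only on the partition generated by the random variable. -/
theorem entropy_congr {q : Ω → ℝ} (hq : ∀ ω, 0 ≤ q ω) {A : Ω → α} {B : Ω → β}
    (h : ∀ ω ω', A ω = A ω' ↔ B ω = B ω') : entropy q A = entropy q B :=
  le_antisymm (entropy_le_of_imp hq fun _ _ => (h _ _).2)
    (entropy_le_of_imp hq fun _ _ => (h _ _).1)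

/-- Gibbs' inequality. -/
theorem entropy_le_of_sum_le {q : Ω → ℝ} (hq : ∀ ω, 0 ≤ q ω) (A : Ω → α) {r : α → ℝ}
    (hr : ∀ a, 0 ≤ r a) (hpos : ∀ ω, 0 < q ω → 0 < r (A ω)) (hsum : ∑ a, r a ≤ ∑ ω, q ω) :
    entropy q A ≤ -∑ ω, q ω * Real.logb 2 (r (A ω)) := by
  rw [entropy_eq_sum, neg_le_neg_iff, ← sub_nonpos, ← Finset.sum_sub_distrib]
  have hlog2 : 0 < Real.log 2 := Real.log_pos one_lt_two
  -- log t ≤ t - 1 at the likelihood ratio t = r / law; summed over the values of `A`, the right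
  -- side is at most ∑ r - ∑ q.
  have key : ∀ ω, q ω * Real.logb 2 (r (A ω)) - q ω * Real.logb 2 (law q A (A ω)) ≤
      (q ω * (r (A ω) / law q A (A ω)) - q ω) / Real.log 2 := by
    intro ω
    rcases (hq ω).eq_or_lt with h0 | h0
    · simp [← h0]
    · have hl := law_pos_of_pos hq A h0
      have h1 := Real.log_le_sub_one_of_pos (div_pos (hpos ω h0) hl)
      rw [Real.log_div (hpos ω h0).ne' hl.ne'] at h1
      rw [Real.logb, Real.logb, ← mul_sub, ← sub_div, ← mul_div_assoc]
      refine div_le_div_of_nonneg_right ?_ hlog2.le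
      have := mul_le_mul_of_nonneg_left h1 h0.le
      linarith
  refine (Finset.sum_le_sum fun ω _ => key ω).trans ?_
  rw [← Finset.sum_div, Finset.sum_sub_distrib]
  refine div_nonpos_of_nonpos_of_nonneg ?_ hlog2.le
  rw [← sum_law_mul q A (fun a => r a / law q A a), sub_nonpos]
  refine (Finset.sum_le_sum fun a _ => ?_).trans hsum
  rcases (law_nonneg hq A a).eq_or_lt with h0 | h0
  · simp [← h0, hr]
  · exact (mul_div_cancel₀ _ h0.ne').le

/-- Submodularity of entropy. -/
theorem entropy_submodular {q : Ω → ℝ} (hq : ∀ ω, 0 ≤ q ω) (A : Ω → α) (B : Ω → β) (C : Ω → γ) :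
    entropy q (fun ω => (A ω, B ω, C ω)) + entropy q C ≤
      entropy q (fun ω => (A ω, C ω)) + entropy q (fun ω => (B ω, C ω)) := by
  -- Gibbs' inequality against the measure p(a,c) p(b,c) / p(c), which makes `A` and `B`
  -- conditionally independent given `C`.
  have h := entropy_le_of_sum_le hq (fun ω => (A ω, B ω, C ω))
    (r := fun v => law q (fun ω => (A ω, C ω)) (v.1, v.2.2) *
      law q (fun ω => (B ω, C ω)) v.2 / law q C v.2.2)
    (fun v => div_nonneg (mul_nonneg (law_nonneg hq _ _) (law_nonneg hq _ _)) (law_nonneg hq _ _))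
    (fun ω h => div_pos (mul_pos (law_pos_of_pos hq (fun ω => (A ω, C ω)) h)
      (law_pos_of_pos hq (fun ω => (B ω, C ω)) h)) (law_pos_of_pos hq C h))
    (by
      rw [Fintype.sum_prod_type, Finset.sum_comm, ← sum_law q (fun ω => (B ω, C ω))]
      refine Finset.sum_le_sum fun v _ => ?_
      dsimp only
      rw [← Finset.sum_div, ← Finset.sum_mul, sum_law_fst]
      rcases (law_nonneg hq C v.2).eq_or_lt with h0 | h0
      · simp [← h0, law_nonneg hq]
      · rw [mul_div_cancel_left₀ _ h0.ne'])
  have e : -∑ ω, q ω * Real.logb 2 (law q (fun ω => (A ω, C ω)) (A ω, C ω) *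
      law q (fun ω => (B ω, C ω)) (B ω, C ω) / law q C (C ω)) =
      entropy q (fun ω => (A ω, C ω)) + entropy q (fun ω => (B ω, C ω)) - entropy q C := by
    rw [entropy_eq_sum, entropy_eq_sum, entropy_eq_sum, sub_neg_eq_add, ← neg_add,
      ← sub_eq_neg_add, ← neg_sub, neg_inj, ← Finset.sum_add_distrib, ← Finset.sum_sub_distrib]
    refine Finset.sum_congr rfl fun ω _ => ?_
    rcases (hq ω).eq_or_lt with h0 | h0
    · simp [← h0]
    · have h1 := (law_pos_of_pos hq (fun ω => (A ω, C ω)) h0).ne'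
      have h2 := (law_pos_of_pos hq (fun ω => (B ω, C ω)) h0).ne'
      rw [Real.logb_div (mul_ne_zero h1 h2) (law_pos_of_pos hq C h0).ne', Real.logb_mul h1 h2]
      ring
  linarith

/-- Conditioning reduces entropy. -/
theorem condEntropy_prod_le {q : Ω → ℝ} (hq : ∀ ω, 0 ≤ q ω) (A : Ω → α) (B : Ω → β) (C : Ω → γ) :
    condEntropy q A (fun ω => (B ω, C ω)) ≤ condEntropy q A C := by
  rw [condEntropy_eq hq, condEntropy_eq hq]
  linarith [entropy_submodular hq A B C]

theorem condMutualInfo_nonneg {q : Ω → ℝ} (hq : ∀ ω, 0 ≤ q ω) (A : Ω → α) (B : Ω → β)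
    (C : Ω → γ) : 0 ≤ condMutualInfo q A B C :=
  sub_nonneg.2 (condEntropy_prod_le hq A B C)

/-- Symmetry of conditional mutual information. -/
theorem condMutualInfo_comm {q : Ω → ℝ} (hq : ∀ ω, 0 ≤ q ω) (A : Ω → α) (B : Ω → β)
    (C : Ω → γ) : condMutualInfo q A B C = condMutualInfo q B A C := by
  have : entropy q (fun ω => (A ω, B ω, C ω)) = entropy q (fun ω => (B ω, A ω, C ω)) :=
    entropy_congr hq fun ω ω' => by simp only [Prod.mk.injEq]; tauto
  rw [condMutualInfo, condMutualInfo, condEntropy_eq hq, condEntropy_eq hq, condEntropy_eq hq,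
    condEntropy_eq hq]
  linarith

/-- A variable with `M` values adds at most `log₂ M` bits. -/
theorem entropy_prod_le_add_logb {q : Ω → ℝ} (hq : ∀ ω, 0 ≤ q ω) (h1 : ∑ ω, q ω = 1)
    (A : Ω → α) (B : Ω → β) :
    entropy q (fun ω => (A ω, B ω)) ≤ entropy q B + Real.logb 2 (Fintype.card α) := by
  obtain ⟨ω₀, -⟩ : ∃ ω, 0 < q ω := by
    by_contra! h
    have := Finset.sum_nonpos fun ω (_ : ω ∈ Finset.univ) => h ω
    linarith
  have hc : (0 : ℝ) < Fintype.card α := by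
    exact_mod_cast Fintype.card_pos_iff.2 ⟨A ω₀⟩
  -- The reference measure is the law of `B` times the uniform law on `α`.
  have h := entropy_le_of_sum_le hq (fun ω => (A ω, B ω))
    (r := fun v => law q B v.2 / Fintype.card α)
    (fun v => div_nonneg (law_nonneg hq _ _) hc.le)
    (fun ω h => div_pos (law_pos_of_pos hq B h) hc)
    (by
      rw [Fintype.sum_prod_type]
      simp only [← Finset.sum_div, sum_law]
      rw [Finset.sum_const, Finset.card_univ, nsmul_eq_mul, mul_div_cancel_left₀ _ hc.ne'])
  refine h.trans (le_of_eq ?_)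
  rw [entropy_eq_sum, neg_add_eq_sub, ← neg_sub, neg_inj]
  rw [← one_mul (Real.logb 2 (Fintype.card α)), ← h1, Finset.sum_mul, ← Finset.sum_sub_distrib]
  refine Finset.sum_congr rfl fun ω _ => ?_
  rcases (hq ω).eq_or_lt with h0 | h0
  · simp [← h0]
  · rw [Real.logb_div (law_pos_of_pos hq B h0).ne' hc.ne']
    ring

end Entropy

/-! ### Product measures and i.i.d. blocks. -/

section Product

variable {ι α β : Type*} [Fintype ι] [DecidableEq ι] [Fintype α]

/-- Resampling one coordinate of a product law does not change expectations. -/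
theorem sum_prod_mul_eq_sum_update {p : α → ℝ} (h1 : ∑ v, p v = 1) (i : ι)
    (F : (ι → α) → ℝ) :
    ∑ s : ι → α, (∏ j, p (s j)) * F s =
      ∑ s : ι → α, (∏ j, p (s j)) * ∑ v, p v * F (Function.update s i v) := by
  -- Exchanging coordinate `i` with an independent fresh sample is an involution that preserves the
  -- product weight.
  let e : (ι → α) × α → (ι → α) × α := fun x => (Function.update x.1 i x.2, x.1 i)
  have he : Function.Involutive e := by
    rintro ⟨s, v⟩
    simp [e]
  have h := Equiv.sum_comp he.toPerm fun x : (ι → α) × α => (∏ j, p (x.1 j)) * (p x.2 * F x.1)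
  rw [Fintype.sum_prod_type, Fintype.sum_prod_type] at h
  have h2 : ∑ s : ι → α, ∑ v, (∏ j, p (s j)) * (p v * F s) = ∑ s : ι → α, (∏ j, p (s j)) * F s := by
    refine Finset.sum_congr rfl fun s _ => ?_
    rw [← Finset.mul_sum, ← Finset.sum_mul, h1, one_mul]
  rw [← h2, ← h]
  refine Finset.sum_congr rfl fun s _ => ?_
  rw [Finset.mul_sum]
  refine Finset.sum_congr rfl fun v _ => ?_
  simp only [Function.Involutive.coe_toPerm, e]
  rw [← mul_assoc, ← mul_assoc]
  congr 1
  rw [← Finset.mul_prod_erase _ _ (Finset.mem_univ i),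
    ← Finset.mul_prod_erase Finset.univ (fun j => p (s j)) (Finset.mem_univ i)]
  have : ∏ x ∈ Finset.univ.erase i, p (Function.update s i v x) =
      ∏ x ∈ Finset.univ.erase i, p (s x) :=
    Finset.prod_congr rfl fun j hj => by rw [Function.update_of_ne (Finset.ne_of_mem_erase hj)]
  rw [this, Function.update_self]
  ring

theorem sum_prod_eq_one {p : α → ℝ} (h1 : ∑ v, p v = 1) :
    ∑ s : ι → α, ∏ j, p (s j) = 1 := by
  classical
  rw [← Fintype.piFinset_univ, ← Finset.prod_univ_sum]
  simp [h1]

theorem sum_prod_mul_eval {p : α → ℝ} (h1 : ∑ v, p v = 1) (i : ι) (g : α → ℝ) :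
    ∑ s : ι → α, (∏ j, p (s j)) * g (s i) = ∑ v, p v * g v := by
  classical
  rw [sum_prod_mul_eq_sum_update h1 i]
  simp only [Function.update_self]
  rw [← Finset.sum_mul, sum_prod_eq_one h1, one_mul]

theorem law_prod (p : α → ℝ) (f : α → β) (b : ι → β) :
    law (fun s : ι → α => ∏ j, p (s j)) (fun s j => f (s j)) b = ∏ j, law p f (b j) := by
  classical
  simp_rw [law_eq_sum_ite]
  rw [Finset.prod_univ_sum, Fintype.piFinset_univ]
  refine Finset.sum_congr rfl fun s _ => ?_
  by_cases h : (fun j => f (s j)) = b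
  · subst h
    simp
  · rw [if_neg h]
    obtain ⟨j, hj⟩ : ∃ j, f (s j) ≠ b j := by
      by_contra! h'
      exact h (funext h')
    exact (Finset.prod_eq_zero (Finset.mem_univ j) (if_neg hj)).symm

/-- The entropy of an i.i.d. block is additive. -/
theorem entropy_prod [Fintype β] {p : α → ℝ} (hp : ∀ v, 0 ≤ p v) (h1 : ∑ v, p v = 1) (f : α → β) :
    entropy (fun s : ι → α => ∏ j, p (s j)) (fun s j => f (s j)) =
      Fintype.card ι * entropy p f := by
  rw [entropy_eq_sum, entropy_eq_sum]
  have : ∀ s : ι → α, (∏ j, p (s j)) *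
      Real.logb 2 (law (fun s : ι → α => ∏ j, p (s j)) (fun s j => f (s j)) (fun j => f (s j))) =
      ∑ i, (∏ j, p (s j)) * Real.logb 2 (law p f (f (s i))) := by
    intro s
    rw [law_prod, ← Finset.mul_sum]
    rcases eq_or_ne (∏ j, p (s j)) 0 with h0 | h0
    · simp [h0]
    · rw [Real.logb_prod]
      intro j _
      have hj := (Finset.prod_ne_zero_iff.1 h0) j (Finset.mem_univ j)
      exact (law_pos_of_pos hp f ((hp _).lt_of_ne' hj)).ne'
  rw [Finset.sum_congr rfl fun s _ => this s, Finset.sum_comm]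
  simp_rw [fun i => sum_prod_mul_eval h1 i (fun v => Real.logb 2 (law p f (f v)))]
  simp

end Product

/-! ### Conditional laws from factorizations. -/

section Kernel

theorem nonempty_of_mem_stdSimplex {ι : Type*} [Fintype ι] {f : ι → ℝ} (hf : f ∈ stdSimplex ℝ ι) :
    Nonempty ι := by
  by_contra h
  rw [not_nonempty_iff] at h
  simpa using hf.2

/-- A conditional law can be extracted from a factorization of the joint law. -/
theorem exists_kernel_of_factorization {A B C : Type*} [Fintype C] [Nonempty C]
    {F : A → B → C → ℝ} (hF : ∀ a b c, 0 ≤ F a b c) {f : A → B → ℝ} {h : A → C → ℝ}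
    (hfac : ∀ a b c, F a b c = f a b * h a c) :
    ∃ κ : A → C → ℝ, (∀ a, κ a ∈ stdSimplex ℝ C) ∧
      ∀ a b c, F a b c = (∑ c', F a b c') * κ a c := by
  classical
  have key : ∀ a, ∃ k ∈ stdSimplex ℝ C, ∀ b c, F a b c = (∑ c', F a b c') * k c := by
    intro a
    by_cases hb : ∃ b, ∑ c, F a b c ≠ 0
    · obtain ⟨b₀, hb₀⟩ := hb
      have hsum : ∀ b, ∑ c, F a b c = f a b * ∑ c, h a c := fun b => by
        rw [Finset.mul_sum]
        exact Finset.sum_congr rfl fun c _ => hfac a b c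
      have hh : ∑ c, h a c ≠ 0 := fun h0 => hb₀ (by rw [hsum, h0, mul_zero])
      have hf : f a b₀ ≠ 0 := fun h0 => hb₀ (by rw [hsum, h0, zero_mul])
      refine ⟨fun c => h a c / ∑ c', h a c', ⟨fun c => ?_, ?_⟩, fun b c => ?_⟩
      -- The factors `f` and `h` carry no sign; positivity of the normalized `h` is read off from
      -- `F` at a `b₀` with nonzero mass.
      · have : h a c / ∑ c', h a c' = F a b₀ c / ∑ c', F a b₀ c' := by
          rw [hsum, hfac, mul_div_mul_left _ _ hf]
        change 0 ≤ h a c / ∑ c', h a c'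
        rw [this]
        exact div_nonneg (hF _ _ _) (Finset.sum_nonneg fun _ _ => hF _ _ _)
      · rw [← Finset.sum_div, div_self hh]
      · rw [hsum, hfac, mul_assoc, mul_div_cancel₀ _ hh]
    · push Not at hb
      obtain ⟨c₀⟩ := ‹Nonempty C›
      refine ⟨Pi.single c₀ 1, single_mem_stdSimplex ℝ c₀, fun b c => ?_⟩
      rw [hb, zero_mul]
      exact (Finset.sum_eq_zero_iff_of_nonneg fun c _ => hF a b c).1 (hb b) c (Finset.mem_univ c)
  choose κ h1 h2 using key
  exact ⟨κ, h1, h2⟩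

end Kernel

/-! ### Membership in the single-letter region from two marginals. -/

section InformationRegion

theorem jointLaw_nonneg {X Y Z U W : Type*} [Fintype U] [Fintype W] {p : X × Y × Z → ℝ}
    (hp : ∀ v, 0 ≤ p v) {pU : Y → U → ℝ} {pW : X → U → W → ℝ}
    (hU : ∀ y, pU y ∈ stdSimplex ℝ U) (hW : ∀ x u, pW x u ∈ stdSimplex ℝ W)
    (t : X × Y × Z × U × W) : 0 ≤ jointLaw p pU pW t :=
  mul_nonneg (mul_nonneg (hp _) ((hU _).1 _)) ((hW _ _).1 _)

variable {X Y Z Xhat : Type*} [Fintype X] [Fintype Y] [Fintype Z]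

theorem law_of_injective {Ω β : Type*} [Fintype Ω] (q : Ω → ℝ) {f : Ω → β}
    (hf : Function.Injective f) (ω : Ω) : law q f (f ω) = q ω := by
  classical
  rw [law_eq_sum_ite]
  simp [hf.eq_iff]

theorem law_jointLaw_xyzu {U W : Type*} [Fintype U] [Fintype W] (p : X × Y × Z → ℝ)
    (pU : Y → U → ℝ) {pW : X → U → W → ℝ} (hW : ∀ x u, pW x u ∈ stdSimplex ℝ W)
    (x : X) (y : Y) (z : Z) (u : U) :
    law (jointLaw p pU pW) (fun t => (t.1, t.2.1, t.2.2.1, t.2.2.2.1)) (x, y, z, u) =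
      p (x, y, z) * pU y u := by
  rw [← sum_law_snd _ _ (fun t => t.2.2.2.2)]
  have : ∀ w, law (jointLaw p pU pW)
      (fun t => ((t.1, t.2.1, t.2.2.1, t.2.2.2.1), t.2.2.2.2)) ((x, y, z, u), w) =
      p (x, y, z) * pU y u * pW x u w := fun w =>
    law_of_injective (jointLaw p pU pW)
      (f := fun t => ((t.1, t.2.1, t.2.2.1, t.2.2.2.1), t.2.2.2.2))
      (by rintro ⟨_, _, _, _, _⟩ ⟨_, _, _, _, _⟩ h; simpa [and_assoc] using h) (x, y, z, u, w)
  simp_rw [this]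
  rw [← Finset.mul_sum, (hW x u).2, mul_one]

theorem law_jointLaw_xzuw {U W : Type*} [Fintype U] [Fintype W] (p : X × Y × Z → ℝ)
    (pU : Y → U → ℝ) (pW : X → U → W → ℝ)
    (x : X) (z : Z) (u : U) (w : W) :
    law (jointLaw p pU pW) (fun t => (t.1, t.2.2.1, t.2.2.2.1, t.2.2.2.2)) (x, z, u, w) =
      (∑ y, p (x, y, z) * pU y u) * pW x u w := by
  rw [← sum_law_snd _ _ (fun t => t.2.1), Finset.sum_mul]
  refine Finset.sum_congr rfl fun y _ => ?_
  exact law_of_injective (jointLaw p pU pW)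
      (f := fun t => ((t.1, t.2.2.1, t.2.2.2.1, t.2.2.2.2), t.2.1))
      (by rintro ⟨_, _, _, _, _⟩ ⟨_, _, _, _, _⟩ h; simp at h ⊢; tauto) (x, y, z, u, w)

/-- A pair of rates lies in the single-letter region as soon as random variables on some finite
probability space have the required marginals: only the joint laws of `(X,Y,Z,U)` and of
`(X,Z,U,W)` matter. -/
theorem mem_informationRegion_of_factorization {Ω : Type*} [Fintype Ω] {q : Ω → ℝ}
    (hq : ∀ ω, 0 ≤ q ω) {p : X × Y × Z → ℝ} {k l : ℕ} [NeZero k] [NeZero l]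
    {d : X → Xhat → ℝ} {D : ℝ} {r : ℝ × ℝ}
    (S : Ω → X × Y × Z) (U : Ω → Fin k) (W : Ω → Fin l) (xhat : Fin k → Fin l → Z → Xhat)
    (hS : law q S = p)
    {g : Y → Fin k → ℝ}
    (hU : ∀ x y z u, law q (fun ω => ((S ω).1, (S ω).2.1, (S ω).2.2, U ω)) (x, y, z, u) =
      p (x, y, z) * g y u)
    {a : X → Z → ℝ} {h : X → Fin k → Fin l → ℝ}
    (hW : ∀ x z u w, law q (fun ω => ((S ω).1, (S ω).2.2, U ω, W ω)) (x, z, u, w) =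
      a x z * h x u w)
    (hR₁ : condMutualInfo q U (fun ω => (S ω).2.1) (fun ω => (S ω).2.2) ≤ r.2)
    (hR : condMutualInfo q (fun ω => (S ω).1) W (fun ω => (U ω, (S ω).2.2)) ≤ r.1)
    (hD : ∑ ω, q ω * d (S ω).1 (xhat (U ω) (W ω) (S ω).2.2) ≤ D) :
    r ∈ informationRegion p d D := by
  obtain ⟨pU, hpU, hpU'⟩ := exists_kernel_of_factorization (A := Y) (B := X × Z) (C := Fin k)
    (F := fun y v u => law q (fun ω => ((S ω).1, (S ω).2.1, (S ω).2.2, U ω)) (v.1, y, v.2, u))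
    (fun _ _ _ => law_nonneg hq _ _) (f := fun y v => p (v.1, y, v.2)) (h := g)
    (fun y v u => hU _ _ _ _)
  obtain ⟨pW, hpW, hpW'⟩ := exists_kernel_of_factorization (A := X × Fin k) (B := Z) (C := Fin l)
    (F := fun v z w => law q (fun ω => ((S ω).1, (S ω).2.2, U ω, W ω)) (v.1, z, v.2, w))
    (fun _ _ _ => law_nonneg hq _ _) (f := fun v z => a v.1 z) (h := fun v w => h v.1 v.2 w)
    (fun v z w => hW _ _ _ _)
  -- The law rebuilt from `pU` and `pW` need not be the joint law under `q`: `W` is replaced by a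
  -- copy drawn from (X,U) alone. The two marginals `e1` and `e2` survive, and they determine all
  -- three costs.
  have e1 : law (jointLaw p pU fun x u => pW (x, u))
      (fun t => (t.1, t.2.1, t.2.2.1, t.2.2.2.1)) =
      law q (fun ω => ((S ω).1, (S ω).2.1, (S ω).2.2, U ω)) := by
    funext ⟨x, y, z, u⟩
    rw [law_jointLaw_xyzu _ _ (fun x u => hpW (x, u)), hpU' y (x, z) u]
    congr 1
    dsimp only
    have h3 : ∀ u, law q (fun ω => ((S ω).1, (S ω).2.1, (S ω).2.2, U ω)) (x, y, z, u) =
        law q (fun ω => (S ω, U ω)) ((x, y, z), u) := by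
      classical
      intro u
      rw [law_eq_sum_ite, law_eq_sum_ite]
      refine Finset.sum_congr rfl fun ω _ => ?_
      simp only [Prod.ext_iff, and_assoc]
    simp_rw [h3]
    rw [sum_law_snd, hS]
  have e2 : law (jointLaw p pU fun x u => pW (x, u))
      (fun t => (t.1, t.2.2.1, t.2.2.2.1, t.2.2.2.2)) =
      law q (fun ω => ((S ω).1, (S ω).2.2, U ω, W ω)) := by
    funext ⟨x, z, u, w⟩
    rw [law_jointLaw_xzuw, hpW' (x, u) z w]
    congr 1
    dsimp only
    have h3 : ∀ w, law q (fun ω => ((S ω).1, (S ω).2.2, U ω, W ω)) (x, z, u, w) =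
        law q (fun ω => (((S ω).1, (S ω).2.2, U ω), W ω)) ((x, z, u), w) := by
      classical
      intro u
      rw [law_eq_sum_ite, law_eq_sum_ite]
      refine Finset.sum_congr rfl fun ω _ => ?_
      simp only [Prod.ext_iff, and_assoc]
    simp_rw [h3]
    rw [sum_law_snd, ← law_comp_eq_of_law_eq e1 (fun v => (v.1, v.2.2.1, v.2.2.2)),
      ← sum_law_snd _ _ (fun t => t.2.1)]
    refine Finset.sum_congr rfl fun y _ => ?_
    rw [← law_jointLaw_xyzu p pU (fun x u => hpW (x, u))]
    classical
    rw [law_eq_sum_ite, law_eq_sum_ite]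
    refine Finset.sum_congr rfl fun ω _ => if_congr ?_ rfl rfl
    simp only [Prod.ext_iff]
    tauto
  refine ⟨k, l, pU, fun x u => pW (x, u), xhat, hpU, fun x u => hpW (x, u), ?_, ?_, ?_⟩
  · refine le_of_eq_of_le ?_ hR₁
    rw [condMutualInfo, condMutualInfo]
    congr 1
    · exact condEntropy_congr_law (law_comp_eq_of_law_eq e1 (fun v => (v.2.2.2, v.2.2.1)))
    · exact condEntropy_congr_law (law_comp_eq_of_law_eq e1 (fun v => (v.2.2.2, v.2.1, v.2.2.1)))
  · refine le_of_eq_of_le ?_ hR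
    rw [condMutualInfo, condMutualInfo]
    congr 1
    · exact condEntropy_congr_law (law_comp_eq_of_law_eq e2 (fun v => (v.1, v.2.2.1, v.2.1)))
    · exact condEntropy_congr_law
        (law_comp_eq_of_law_eq e2 (fun v => (v.1, v.2.2.2, v.2.2.1, v.2.1)))
  · refine le_of_eq_of_le ?_ hD
    have := sum_law_mul q (fun ω => ((S ω).1, (S ω).2.2, U ω, W ω))
      (fun v => d v.1 (xhat v.2.2.1 v.2.2.2 v.2.1))
    rw [← this, ← e2, sum_law_mul]
    simp only [Fintype.sum_prod_type]

end InformationRegion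

/-! ### Uniform time-sharing index. -/

section TimeSharing

variable {n : ℕ} {Ω α γ : Type*} [Fintype Ω]

/-- Since `B` reveals the index, only one time slice contributes. The factor 1/n later cancels in
conditional probabilities. -/
theorem law_timeSharing (q : Ω → ℝ) (B : Fin n × Ω → γ)
    (hB : ∀ v v', B v = B v' → v.1 = v'.1) (i : Fin n) (ω : Ω) :
    law (fun v : Fin n × Ω => (1 / (n : ℝ)) * q v.2) B (B (i, ω)) =
      (1 / (n : ℝ)) * law q (fun ω => B (i, ω)) (B (i, ω)) := by
  classical
  rw [law_eq_sum_ite, law_eq_sum_ite, Fintype.sum_prod_type, Finset.mul_sum,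
    Finset.sum_eq_single i]
  · simp only [mul_ite, mul_zero]
  · intro j _ hj
    refine Finset.sum_eq_zero fun ω' _ => if_neg fun h => hj (hB _ _ h)
  · simp

/-- Conditional entropy given a uniform time-sharing index. -/
theorem condEntropy_timeSharing [Fintype α] [Fintype γ] (hn : n ≠ 0) (q : Ω → ℝ)
    (A : Fin n × Ω → α) (C : Fin n × Ω → γ) (hC : ∀ v v', C v = C v' → v.1 = v'.1) :
    condEntropy (fun v : Fin n × Ω => (1 / (n : ℝ)) * q v.2) A C =
      (1 / (n : ℝ)) * ∑ i, condEntropy q (fun ω => A (i, ω)) (fun ω => C (i, ω)) := by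
  have hn' : (1 / (n : ℝ)) ≠ 0 := one_div_ne_zero (Nat.cast_ne_zero.2 hn)
  rw [condEntropy_eq_sum]
  simp_rw [condEntropy_eq_sum]
  rw [Finset.sum_neg_distrib, mul_neg, Fintype.sum_prod_type, Finset.mul_sum, neg_inj]
  refine Finset.sum_congr rfl fun i _ => ?_
  rw [Finset.mul_sum]
  refine Finset.sum_congr rfl fun ω _ => ?_
  rw [law_timeSharing q (fun v => (A v, C v)) (fun v v' h => hC v v' (Prod.ext_iff.1 h).2),
    law_timeSharing q C hC, mul_div_mul_left _ _ hn', mul_assoc]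

end TimeSharing

/-! ### Converse: telescoping bounds on the two rates. -/

section Converse

variable {X Y Z Xhat : Type*} {n M₁ M : ℕ}

/-- The helper message as a function of the source block. -/
def Code.helperMessage (c : Code X Y Z Xhat n M₁ M) (s : Fin n → X × Y × Z) : Fin M₁ :=
  c.helper fun i => (s i).2.1

/-- The encoder message as a function of the source block. -/
def Code.message (c : Code X Y Z Xhat n M₁ M) (s : Fin n → X × Y × Z) : Fin M :=
  c.encoder (fun i => (s i).1) (c.helperMessage s)

/-- The components of `f` at times before `i`. -/
def past {α β : Type*} (f : α → β) (i : ℕ) (s : Fin n → α) : Fin n → Option β :=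
  fun j => if (j : ℕ) < i then some (f (s j)) else none

/-- The components of `f` at times other than `i`. -/
def others {α β : Type*} (f : α → β) (i : Fin n) (s : Fin n → α) : Fin n → Option β :=
  fun j => if j = i then none else some (f (s j))

theorem past_eq_iff {α β : Type*} {f : α → β} {i : ℕ} {s s' : Fin n → α} :
    past f i s = past f i s' ↔ ∀ j : Fin n, (j : ℕ) < i → f (s j) = f (s' j) := by
  rw [funext_iff]
  refine forall_congr' fun j => ?_
  by_cases h : (j : ℕ) < i <;> simp [past, h]

theorem past_succ_eq_iff {α β : Type*} {f : α → β} {i : Fin n} {s s' : Fin n → α} :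
    past f (i + 1) s = past f (i + 1) s' ↔ f (s i) = f (s' i) ∧ past f i s = past f i s' := by
  simp_rw [past_eq_iff]
  constructor
  · exact fun h => ⟨h i (by omega), fun j hj => h j (by omega)⟩
  · rintro ⟨h1, h2⟩ j hj
    rcases Nat.lt_succ_iff_lt_or_eq.1 hj with h | h
    · exact h2 j h
    · rwa [Fin.ext h]

theorem past_zero_eq {α β : Type*} (f : α → β) (s s' : Fin n → α) :
    past f 0 s = past f 0 s' := by
  rw [past_eq_iff]; intro j hj; omega

theorem others_eq_iff {α β : Type*} {f : α → β} {i : Fin n} {s s' : Fin n → α} :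
    others f i s = others f i s' ↔ ∀ j, j ≠ i → f (s j) = f (s' j) := by
  rw [funext_iff]
  refine forall_congr' fun j => ?_
  by_cases h : j = i <;> simp [others, h]

theorem others_and_self_eq_iff {α β : Type*} {f : α → β} {i : Fin n} {s s' : Fin n → α} :
    (others f i s = others f i s' ∧ f (s i) = f (s' i)) ↔
      (fun j => f (s j)) = fun j => f (s' j) := by
  rw [others_eq_iff, funext_iff]
  constructor
  · rintro ⟨h1, h2⟩ j
    by_cases h : j = i
    · rwa [h]
    · exact h1 j h
  · exact fun h => ⟨fun j _ => h j, h i⟩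

/-- The auxiliary variable `U` of the converse: the time index, the helper message, the past of
`X` and the side information at all other times. -/
def Code.aux (c : Code X Y Z Xhat n M₁ M) (v : Fin n × (Fin n → X × Y × Z)) :
    Fin n × Fin M₁ × (Fin n → Option X) × (Fin n → Option Z) :=
  (v.1, c.helperMessage v.2, past Prod.fst v.1 v.2, others (fun t => t.2.2) v.1 v.2)

/-- The missing Z_i completes the block Zⁿ, so conditioning on (U, Z_i) is conditioning on (X^{i-1},
T₁, Zⁿ), a family that grows with i only through X. -/
theorem Code.aux_and_self_eq_iff (c : Code X Y Z Xhat n M₁ M) (i : Fin n)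
    (s s' : Fin n → X × Y × Z) :
    (c.aux (i, s) = c.aux (i, s') ∧ (s i).2.2 = (s' i).2.2) ↔
      past Prod.fst i s = past Prod.fst i s' ∧ c.helperMessage s = c.helperMessage s' ∧
        (fun j => (s j).2.2) = fun j => (s' j).2.2 := by
  have := others_and_self_eq_iff (f := fun t : X × Y × Z => t.2.2) (i := i) (s := s) (s' := s')
  simp only [Code.aux, Prod.mk.injEq]
  tauto

variable [Fintype X] [Fintype Y] [Fintype Z]

section Entropy

variable {p : X × Y × Z → ℝ}

theorem prod_nonneg_of_mem {α : Type*} [Fintype α] {p : α → ℝ} (hp : p ∈ stdSimplex ℝ α)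
    (s : Fin n → α) : 0 ≤ ∏ j, p (s j) :=
  Finset.prod_nonneg fun _ _ => hp.1 _

theorem law_prod_eval {α β : Type*} [Fintype α] {p : α → ℝ} (h1 : ∑ v, p v = 1) (i : Fin n)
    (f : α → β) : law (fun s : Fin n → α => ∏ j, p (s j)) (fun s => f (s i)) = law p f := by
  classical
  funext b
  rw [law_eq_sum_ite, law_eq_sum_ite]
  simpa using sum_prod_mul_eval h1 i (fun v => if f v = b then 1 else 0)

/-- The helper rate bounds the sum of the single-letter informations. -/
theorem Code.sum_helper_le (hp : p ∈ stdSimplex ℝ (X × Y × Z)) (c : Code X Y Z Xhat n M₁ M) :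
    n * condEntropy p (fun t => t.2.1) (fun t => t.2.2) -
      ∑ i, condEntropy (fun s : Fin n → X × Y × Z => ∏ j, p (s j)) (fun s => (s i).2.1)
        (fun s => (c.aux (i, s), (s i).2.2)) ≤ Real.logb 2 M₁ := by
  set P : (Fin n → X × Y × Z) → ℝ := fun s => ∏ j, p (s j) with hP
  have hP0 : ∀ s, 0 ≤ P s := prod_nonneg_of_mem hp
  have hP1 : ∑ s, P s = 1 := sum_prod_eq_one hp.2
  -- Adding the past of Y to the conditioning only lowers H(Y_i | U, Z_i), and then H(V_{i+1}) -
  -- H(V_i) = H(Y_i | V_i) + H(X_i | Y_i, V_i) telescopes.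
  let V : ℕ → (Fin n → X × Y × Z) → (Fin n → Option (X × Y)) × Fin M₁ × (Fin n → Z) := fun i s =>
    (past (fun t => (t.1, t.2.1)) i s, c.helperMessage s, fun j => (s j).2.2)
  have step : ∀ i : Fin n, entropy P (V (i + 1)) - entropy P (V i) -
      condEntropy p (fun t => t.1) (fun t => (t.2.1, t.2.2)) ≤
      condEntropy P (fun s => (s i).2.1) (fun s => (c.aux (i, s), (s i).2.2)) := by
    intro i
    refine le_trans ?_ (condEntropy_prod_le hP0 (fun s => (s i).2.1)
      (past (fun t => (t.1, t.2.1)) i) (fun s => (c.aux (i, s), (s i).2.2)))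
    have h1 : condEntropy P (fun s => (s i).2.1)
        (fun s => (past (fun t => (t.1, t.2.1)) i s, (c.aux (i, s), (s i).2.2))) =
        entropy P (fun s => ((s i).2.1, V i s)) - entropy P (V i) := by
      have hk : ∀ s s' : Fin n → X × Y × Z,
          (past (fun t => (t.1, t.2.1)) (i : ℕ) s = past (fun t => (t.1, t.2.1)) i s' ∧
            c.aux (i, s) = c.aux (i, s') ∧ (s i).2.2 = (s' i).2.2) ↔ V i s = V i s' := by
        intro s s'
        rw [c.aux_and_self_eq_iff]
        simp only [V, Prod.mk.injEq, past_eq_iff]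
        constructor
        · tauto
        · rintro ⟨h1, h2, h3⟩
          exact ⟨h1, fun j hj => (h1 j hj).1, h2, h3⟩
      rw [condEntropy_eq hP0]
      congr 1
      · refine entropy_congr hP0 fun s s' => ?_
        simp only [Prod.mk.injEq, hk]
      · refine entropy_congr hP0 fun s s' => ?_
        rw [Prod.mk.injEq, Prod.mk.injEq, hk]
    have h2 : entropy P (V (i + 1)) =
        entropy P (fun s => ((s i).1, V i s, (s i).2.1, (s i).2.2)) := by
      refine entropy_congr hP0 fun s s' => ?_
      simp only [V, Prod.mk.injEq, past_succ_eq_iff]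
      constructor
      · rintro ⟨⟨⟨h1, h2⟩, h3⟩, h4, h5⟩
        exact ⟨h1, ⟨h3, h4, h5⟩, h2, congrFun h5 i⟩
      · rintro ⟨h1, ⟨h3, h4, h5⟩, h2, -⟩
        exact ⟨⟨⟨h1, h2⟩, h3⟩, h4, h5⟩
    have h3 : entropy P (fun s => ((s i).2.1, V i s)) =
        entropy P (fun s => (V i s, (s i).2.1, (s i).2.2)) := by
      refine entropy_congr hP0 fun s s' => ?_
      simp only [V, Prod.mk.injEq]
      constructor
      · rintro ⟨h1, h3, h4, h5⟩
        exact ⟨⟨h3, h4, h5⟩, h1, congrFun h5 i⟩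
      · tauto
    -- The surplus term H(X_i | Y_i, V_i) is at most the single-letter H(X | Y, Z).
    have h4 := condEntropy_prod_le hP0 (fun s => (s i).1) (V i) (fun s => ((s i).2.1, (s i).2.2))
    have h5 : condEntropy P (fun s => (s i).1) (fun s => ((s i).2.1, (s i).2.2)) =
        condEntropy p (fun t => t.1) (fun t => (t.2.1, t.2.2)) :=
      condEntropy_congr_law (law_prod_eval hp.2 i fun t => (t.1, t.2.1, t.2.2))
    rw [h5, condEntropy_eq hP0] at h4
    rw [h1, h2, h3]
    linarith
  have tele := Finset.sum_le_sum fun i (_ : i ∈ Finset.univ) => step i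
  rw [Finset.sum_sub_distrib, Fin.sum_univ_eq_sum_range
    (fun i => entropy P (V (i + 1)) - entropy P (V i)),
    Finset.sum_range_sub fun i => entropy P (V i), Finset.sum_const, Finset.card_univ, Fintype.card_fin, nsmul_eq_mul] at tele
  -- End points of the telescope: `V n` determines the whole source block, while `V 0` holds only T₁
  -- and Zⁿ. Then H(X,Y,Z) - H(X|Y,Z) - H(Z) = H(Y|Z).
  have hlast : n * entropy p (fun t => t) ≤ entropy P (V n) := by
    have := entropy_prod (ι := Fin n) hp.1 hp.2 (fun t => t)
    rw [Fintype.card_fin] at this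
    rw [← this]
    refine entropy_le_of_imp hP0 fun s s' h => ?_
    simp only [V, Prod.mk.injEq, past_eq_iff] at h
    funext j
    exact Prod.ext (h.1 j j.2).1 (Prod.ext (h.1 j j.2).2 (congrFun h.2.2 j))
  have hfirst : entropy P (V 0) ≤ n * entropy p (fun t => t.2.2) + Real.logb 2 M₁ := by
    have h1 := entropy_prod (ι := Fin n) hp.1 hp.2 (fun t => t.2.2)
    have h2 := entropy_prod_le_add_logb hP0 hP1 c.helperMessage (fun s j => (s j).2.2)
    rw [Fintype.card_fin] at h1 h2
    rw [← h1]
    refine le_trans (entropy_le_of_imp hP0 fun s s' h => ?_) h2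
    simp only [V, Prod.mk.injEq] at h ⊢
    exact ⟨past_zero_eq _ _ _, h⟩
  rw [condEntropy_eq hp.1] at tele ⊢
  have e : entropy p (fun t => (t.1, t.2.1, t.2.2)) = entropy p (fun t => t) := rfl
  rw [e] at tele
  linarith

/-- The encoder rate bounds the sum of the single-letter informations. -/
theorem Code.sum_encoder_le (hp : p ∈ stdSimplex ℝ (X × Y × Z)) (c : Code X Y Z Xhat n M₁ M) :
    ∑ i, (condEntropy (fun s : Fin n → X × Y × Z => ∏ j, p (s j)) (fun s => (s i).1)
        (fun s => (c.aux (i, s), (s i).2.2)) -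
      condEntropy (fun s : Fin n → X × Y × Z => ∏ j, p (s j)) (fun s => (s i).1)
        (fun s => (c.message s, c.aux (i, s), (s i).2.2))) ≤ Real.logb 2 M := by
  set P : (Fin n → X × Y × Z) → ℝ := fun s => ∏ j, p (s j) with hP
  have hP0 : ∀ s, 0 ≤ P s := prod_nonneg_of_mem hp
  have hP1 : ∑ s, P s = 1 := sum_prod_eq_one hp.2
  let A : ℕ → (Fin n → X × Y × Z) → (Fin n → Option X) × Fin M₁ × (Fin n → Z) := fun i s =>
    (past Prod.fst i s, c.helperMessage s, fun j => (s j).2.2)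
  have hk : ∀ (i : Fin n) (s s' : Fin n → X × Y × Z),
      (c.aux (i, s) = c.aux (i, s') ∧ (s i).2.2 = (s' i).2.2) ↔ A i s = A i s' := by
    intro i s s'
    rw [c.aux_and_self_eq_iff]
    simp only [A, Prod.mk.injEq]
  have hk' : ∀ (i : Fin n) (s s' : Fin n → X × Y × Z),
      A (i + 1) s = A (i + 1) s' ↔ (s i).1 = (s' i).1 ∧ A i s = A i s' := by
    intro i s s'
    simp only [A, Prod.mk.injEq, past_succ_eq_iff]
    tauto
  -- By symmetry I(X_i; T | A_i) = H(T | A_i) - H(T | A_{i+1}), since `A (i + 1)` is `A i` together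
  -- with X_i.
  have step : ∀ i : Fin n, condEntropy P (fun s => (s i).1)
        (fun s => (c.aux (i, s), (s i).2.2)) -
      condEntropy P (fun s => (s i).1) (fun s => (c.message s, c.aux (i, s), (s i).2.2)) =
      (entropy P (A (i + 1)) - entropy P (fun s => (c.message s, A (i + 1) s))) -
      (entropy P (A i) - entropy P (fun s => (c.message s, A i s))) := by
    intro i
    rw [condEntropy_eq hP0, condEntropy_eq hP0]
    have h1 : entropy P (fun s => ((s i).1, c.aux (i, s), (s i).2.2)) = entropy P (A (i + 1)) :=
      entropy_congr hP0 fun s s' => by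
        rw [Prod.mk.injEq, Prod.mk.injEq, hk, hk']
    have h2 : entropy P (fun s => (c.aux (i, s), (s i).2.2)) = entropy P (A i) :=
      entropy_congr hP0 fun s s' => by rw [Prod.mk.injEq, hk]
    have h3 : entropy P (fun s => ((s i).1, c.message s, c.aux (i, s), (s i).2.2)) =
        entropy P (fun s => (c.message s, A (i + 1) s)) :=
      entropy_congr hP0 fun s s' => by
        simp only [Prod.mk.injEq, hk, hk']
        tauto
    have h4 : entropy P (fun s => (c.message s, c.aux (i, s), (s i).2.2)) =
        entropy P (fun s => (c.message s, A i s)) :=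
      entropy_congr hP0 fun s s' => by
        simp only [Prod.mk.injEq, hk]
    rw [h1, h2, h3, h4]
    ring
  rw [Finset.sum_congr rfl fun i _ => step i, Fin.sum_univ_eq_sum_range
    (fun i => (entropy P (A (i + 1)) - entropy P (fun s => (c.message s, A (i + 1) s))) -
      (entropy P (A i) - entropy P (fun s => (c.message s, A i s)))),
    Finset.sum_range_sub fun i => entropy P (A i) - entropy P (fun s => (c.message s, A i s))]
  have h1 : entropy P (A n) ≤ entropy P (fun s => (c.message s, A n s)) :=
    entropy_le_of_imp hP0 fun s s' h => (Prod.mk.injEq .. ▸ h).2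
  have h2 := entropy_prod_le_add_logb hP0 hP1 c.message (A 0)
  rw [Fintype.card_fin] at h2
  linarith

end Entropy

end Converse

/-! ### Converse: Markov structure of the auxiliary variables. -/

section Converse

variable {X Y Z Xhat : Type*} {n M₁ M : ℕ}

theorem Code.helperMessage_update (c : Code X Y Z Xhat n M₁ M) (i : Fin n)
    (s : Fin n → X × Y × Z) (x x' : X) (y : Y) (z z' : Z) :
    c.helperMessage (Function.update s i (x, y, z)) =
      c.helperMessage (Function.update s i (x', y, z')) := by
  unfold Code.helperMessage
  congr 1
  funext j
  by_cases h : j = i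
  · subst h; simp
  · simp [h]

/-- The past and the other times skip coordinate `i`, and the helper sees only Y. This is the source
of U - Y - (X,Z). -/
theorem Code.aux_update (c : Code X Y Z Xhat n M₁ M) (i : Fin n)
    (s : Fin n → X × Y × Z) (x x' : X) (y : Y) (z z' : Z) :
    c.aux (i, Function.update s i (x, y, z)) = c.aux (i, Function.update s i (x', y, z')) := by
  simp only [Code.aux, Prod.mk.injEq, true_and, past_eq_iff, others_eq_iff]
  refine ⟨c.helperMessage_update .., fun j hj => ?_, fun j hj => ?_⟩
  · have : j ≠ i := fun h => by simp [h] at hj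
    simp [this]
  · simp [hj]

/-- The encoder never sees Z. Its message may still depend on Y_i through the helper message, so `y`
is held fixed. -/
theorem Code.message_update (c : Code X Y Z Xhat n M₁ M) (i : Fin n)
    (s : Fin n → X × Y × Z) (x : X) (y : Y) (z z' : Z) :
    c.message (Function.update s i (x, y, z)) = c.message (Function.update s i (x, y, z')) := by
  unfold Code.message
  rw [c.helperMessage_update i s x x y z z']
  congr 1
  funext j
  by_cases h : j = i
  · subst h; simp
  · simp [h]

variable [Fintype X] [Fintype Y] [Fintype Z]

theorem law_eq_sum_mul {Ω β : Type*} [Fintype Ω] [DecidableEq β] (q : Ω → ℝ) (f : Ω → β) (b : β) :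
    law q f b = ∑ ω, q ω * if f ω = b then 1 else 0 := by
  simp [law_eq_sum_ite]

theorem sum_timeSharing_resample {α : Type*} [Fintype α] {p : α → ℝ} (h1 : ∑ v, p v = 1)
    (G : Fin n × (Fin n → α) → ℝ) :
    ∑ v : Fin n × (Fin n → α), (1 / (n : ℝ)) * (∏ j, p (v.2 j)) * G v =
      ∑ v : Fin n × (Fin n → α), (1 / (n : ℝ)) * (∏ j, p (v.2 j)) *
        ∑ t, p t * G (v.1, Function.update v.2 v.1 t) := by
  rw [Fintype.sum_prod_type, Fintype.sum_prod_type]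
  refine Finset.sum_congr rfl fun i _ => ?_
  simp_rw [mul_assoc]
  rw [← Finset.mul_sum, ← Finset.mul_sum, sum_prod_mul_eq_sum_update h1 i fun s => G (i, s)]

/-- If p(x) = 0 both sides vanish, so division by zero is harmless. -/
theorem IsMarkovYXZ.eq_div_mul {p : X × Y × Z → ℝ} (hp : ∀ v, 0 ≤ p v) (h : IsMarkovYXZ p)
    (x : X) (y : Y) (z : Z) :
    p (x, y, z) = law p (fun s => (s.1, s.2.2)) (x, z) / law p (fun s => s.1) x *
      law p (fun s => (s.1, s.2.1)) (x, y) := by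
  rcases (law_nonneg hp (fun s => s.1) x).eq_or_lt with h0 | h0
  · rw [← h0, div_zero, zero_mul]
    refine le_antisymm ?_ (hp _)
    rw [h0]
    exact le_law_self hp (fun s => s.1) (x, y, z)
  · rw [div_mul_eq_mul_div, eq_div_iff h0.ne', h x y z, mul_comm]

/-- A block code yields a point of the single-letter region. -/
theorem Code.mem_informationRegion {p : X × Y × Z → ℝ} (hp : p ∈ stdSimplex ℝ (X × Y × Z))
    (hMarkov : IsMarkovYXZ p) {d : X → Xhat → ℝ} {D : ℝ} {r : ℝ × ℝ} (hn : n ≠ 0)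
    (c : Code X Y Z Xhat n M₁ M) (hR₁ : Real.logb 2 M₁ ≤ n * r.2) (hR : Real.logb 2 M ≤ n * r.1)
    (hD : c.expectedDistortion p d ≤ D) : r ∈ informationRegion p d D := by
  classical
  have hn' : (0 : ℝ) < n := by exact_mod_cast Nat.pos_of_ne_zero hn
  obtain ⟨⟨x₀, y₀, z₀⟩⟩ := nonempty_of_mem_stdSimplex hp
  let s₀ : Fin n → X × Y × Z := fun _ => (x₀, y₀, z₀)
  let e := Fintype.equivFin (Fin n × Fin M₁ × (Fin n → Option X) × (Fin n → Option Z))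
  set k := Fintype.card (Fin n × Fin M₁ × (Fin n → Option X) × (Fin n → Option Z))
  have : NeZero k := ⟨fun h => (h ▸ e (c.aux (⟨0, Nat.pos_of_ne_zero hn⟩, s₀)) : Fin 0).elim0⟩
  have : NeZero M := ⟨fun h => (h ▸ c.message s₀ : Fin 0).elim0⟩
  let q : Fin n × (Fin n → X × Y × Z) → ℝ := fun v => (1 / (n : ℝ)) * ∏ j, p (v.2 j)
  have hq : ∀ v, 0 ≤ q v := fun v => mul_nonneg (by positivity) (prod_nonneg_of_mem hp _)
  have hS : law q (fun v => v.2 v.1) = p := by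
    funext t₀
    rw [law_eq_sum_mul, sum_timeSharing_resample hp.2]
    simp only [Function.update_self, mul_ite, mul_one, mul_zero, Finset.sum_ite_eq',
      Finset.mem_univ, if_true]
    rw [← Finset.sum_mul, Fintype.sum_prod_type]
    simp only [← Finset.mul_sum, sum_prod_eq_one hp.2]
    rw [Finset.sum_const, Finset.card_univ, Fintype.card_fin, nsmul_eq_mul]
    field_simp
  refine mem_informationRegion_of_factorization hq (fun v => v.2 v.1) (fun v => e (c.aux v))
    (fun v => c.message v.2)
    -- The only `none` entry of the Z-component of U is at its own time index; filling it with `z`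
    -- restores Zⁿ, and the decoder output is read at that index.
    (fun u w z => c.decoder (fun j => ((e.symm u).2.2.2 j).getD z) (e.symm u).2.1 w (e.symm u).1)
    hS
    -- `x₀` and `z₀` are arbitrary fillers, irrelevant by `Code.aux_update`.
    (g := fun y u => ∑ v, q v * if e (c.aux (v.1, Function.update v.2 v.1 (x₀, y, z₀))) = u
      then 1 else 0)
    (fun x y z u => ?_)
    -- Given x, the letter z is independent of y and affects neither U nor W, so p(z|x) splits off
    -- and the sum over y stays in `h`.
    (a := fun x z => law p (fun s => (s.1, s.2.2)) (x, z) / law p (fun s => s.1) x)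
    (h := fun x u w => ∑ v, q v * ∑ y, law p (fun s => (s.1, s.2.1)) (x, y) *
      if e (c.aux (v.1, Function.update v.2 v.1 (x, y, z₀))) = u ∧
        c.message (Function.update v.2 v.1 (x, y, z₀)) = w then 1 else 0)
    (fun x z u w => ?_) ?_ ?_ ?_
  · rw [law_eq_sum_mul, sum_timeSharing_resample hp.2, Finset.mul_sum]
    refine Finset.sum_congr rfl fun v _ => ?_
    rw [Fintype.sum_eq_single (x, y, z)]
    · rw [c.aux_update v.1 v.2 x x₀ y z z₀]
      simp only [Function.update_self, Prod.mk.injEq, true_and]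
      ring
    · rintro ⟨x', y', z'⟩ h
      rw [if_neg, mul_zero]
      intro h'
      simp only [Function.update_self, Prod.mk.injEq] at h'
      exact h (by simp [h'])
  · rw [law_eq_sum_mul, sum_timeSharing_resample hp.2, Finset.mul_sum]
    refine Finset.sum_congr rfl fun v _ => ?_
    rw [Fintype.sum_prod_type, Fintype.sum_eq_single x, Fintype.sum_prod_type]
    · rw [mul_left_comm]
      congr 1
      rw [Finset.mul_sum]
      refine Finset.sum_congr rfl fun y _ => ?_
      rw [Fintype.sum_eq_single z]
      · rw [c.aux_update v.1 v.2 x x y z z₀, c.message_update v.1 v.2 x y z z₀, ← mul_assoc,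
          ← hMarkov.eq_div_mul hp.1]
        simp only [Function.update_self, Prod.mk.injEq, true_and]
      · intro z' h
        rw [if_neg, mul_zero]
        intro h'
        simp only [Function.update_self, Prod.mk.injEq] at h'
        exact h h'.2.1
    · intro x' h
      refine Finset.sum_eq_zero fun t _ => ?_
      rw [if_neg, mul_zero]
      intro h'
      simp only [Function.update_self, Prod.mk.injEq] at h'
      exact h h'.1
  · rw [condMutualInfo_comm hq, condMutualInfo,
      condEntropy_congr_law (q' := p) (A' := fun t => t.2.1) (C' := fun t => t.2.2)
        (law_comp_eq_of_law_eq (hS.trans (funext fun t => (law_id p t).symm))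
          fun t => (t.2.1, t.2.2))]
    simp only [q]
    rw [condEntropy_timeSharing hn fun s : Fin n → X × Y × Z => ∏ j, p (s j)]
    · have h1 := c.sum_helper_le hp
      have h2 : ∀ i, condEntropy (fun s : Fin n → X × Y × Z => ∏ j, p (s j)) (fun s => (s i).2.1)
          (fun s => (e (c.aux (i, s)), (s i).2.2)) =
          condEntropy (fun s : Fin n → X × Y × Z => ∏ j, p (s j)) (fun s => (s i).2.1)
          (fun s => (c.aux (i, s), (s i).2.2)) := fun i => by
        rw [condEntropy_eq (prod_nonneg_of_mem hp), condEntropy_eq (prod_nonneg_of_mem hp)]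
        congr 1 <;> refine entropy_congr (prod_nonneg_of_mem hp) fun s s' => ?_ <;>
        simp only [Prod.mk.injEq, e.apply_eq_iff_eq]
      simp_rw [h2]
      have h3 := h1.trans hR₁
      rw [← div_le_iff₀' hn'] at h3
      refine le_of_eq_of_le ?_ h3
      field_simp
    · intro v v' h
      simp only [Prod.mk.injEq, e.apply_eq_iff_eq, Code.aux] at h
      exact h.1.1
  · rw [condMutualInfo]
    simp only [q]
    rw [condEntropy_timeSharing hn fun s : Fin n → X × Y × Z => ∏ j, p (s j),
      condEntropy_timeSharing hn fun s : Fin n → X × Y × Z => ∏ j, p (s j), ← mul_sub,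
      ← Finset.sum_sub_distrib]
    · have h1 := c.sum_encoder_le hp
      have h2 : ∀ i, condEntropy (fun s : Fin n → X × Y × Z => ∏ j, p (s j)) (fun s => (s i).1)
          (fun s => (e (c.aux (i, s)), (s i).2.2)) =
          condEntropy (fun s : Fin n → X × Y × Z => ∏ j, p (s j)) (fun s => (s i).1)
          (fun s => (c.aux (i, s), (s i).2.2)) := fun i => by
        rw [condEntropy_eq (prod_nonneg_of_mem hp), condEntropy_eq (prod_nonneg_of_mem hp)]
        congr 1 <;> refine entropy_congr (prod_nonneg_of_mem hp) fun s s' => ?_ <;>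
        simp only [Prod.mk.injEq, e.apply_eq_iff_eq]
      have h3 : ∀ i, condEntropy (fun s : Fin n → X × Y × Z => ∏ j, p (s j)) (fun s => (s i).1)
          (fun s => (c.message s, e (c.aux (i, s)), (s i).2.2)) =
          condEntropy (fun s : Fin n → X × Y × Z => ∏ j, p (s j)) (fun s => (s i).1)
          (fun s => (c.message s, c.aux (i, s), (s i).2.2)) := fun i => by
        rw [condEntropy_eq (prod_nonneg_of_mem hp), condEntropy_eq (prod_nonneg_of_mem hp)]
        congr 1 <;> refine entropy_congr (prod_nonneg_of_mem hp) fun s s' => ?_ <;>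
        simp only [Prod.mk.injEq, e.apply_eq_iff_eq]
      simp_rw [h2, h3]
      have h4 := h1.trans hR
      rw [← div_le_iff₀' hn'] at h4
      refine le_of_eq_of_le ?_ h4
      field_simp
    · intro v v' h
      simp only [Prod.mk.injEq, e.apply_eq_iff_eq, Code.aux] at h
      exact h.2.1.1
    · intro v v' h
      simp only [Prod.mk.injEq, e.apply_eq_iff_eq, Code.aux] at h
      exact h.1.1
  · refine le_of_eq_of_le ?_ hD
    rw [Code.expectedDistortion, Fintype.sum_prod_type, Finset.sum_comm]
    refine Finset.sum_congr rfl fun s _ => ?_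
    rw [Finset.mul_sum, Finset.mul_sum]
    refine Finset.sum_congr rfl fun i _ => ?_
    have : (fun j => ((c.aux (i, s)).2.2.2 j).getD (s i).2.2) = fun j => (s j).2.2 := by
      funext j
      by_cases h : j = i
      · subst h; simp [Code.aux, others]
      · simp [Code.aux, others, h]
    simp only [q, e.symm_apply_apply, this]
    change _ = _ * (_ * d (s i).1 (c.decoder (fun j => (s j).2.2) (c.helperMessage s)
      (c.message s) i))
    simp only [Code.aux]
    ring

/-- `M ≠ 0` matters: for negative `t` the floor is 0, and `Real.logb 2 0 = 0` exceeds `t`. -/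
theorem logb_floor_rpow_le {M : ℕ} {t : ℝ} (hM : M = ⌊(2 : ℝ) ^ t⌋₊) (h0 : M ≠ 0) :
    Real.logb 2 M ≤ t := by
  rw [Real.logb_le_iff_le_rpow one_lt_two (by exact_mod_cast Nat.pos_of_ne_zero h0), hM]
  exact Nat.floor_le (by positivity)

/-- The converse, up to the closedness of the single-letter region. -/
theorem Achievable.mem_informationRegion {p : X × Y × Z → ℝ} (hp : p ∈ stdSimplex ℝ (X × Y × Z))
    (hMarkov : IsMarkovYXZ p) {d : X → Xhat → ℝ} {D : ℝ} {r : ℝ × ℝ} (h : Achievable p d D r)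
    {ε : ℝ} (hε : 0 < ε) : r ∈ informationRegion p d (D + ε) := by
  obtain ⟨n, ⟨c, hc⟩, hn⟩ := ((h ε hε).and (eventually_gt_atTop 0)).exists
  obtain ⟨⟨x₀, y₀, z₀⟩⟩ := nonempty_of_mem_stdSimplex hp
  refine c.mem_informationRegion hp hMarkov hn.ne' (logb_floor_rpow_le rfl ?_)
    (logb_floor_rpow_le rfl ?_) hc
  · exact fun h => (h ▸ c.helperMessage (fun _ => (x₀, y₀, z₀)) : Fin 0).elim0
  · exact fun h => (h ▸ c.message (fun _ => (x₀, y₀, z₀)) : Fin 0).elim0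

end Converse

/-! ### Carathéodory's theorem for cones. -/

section Caratheodory

/-- Carathéodory's theorem for conic combinations: a finite sum of vectors is a nonnegative
combination of a number of them that depends only on the dimension. -/
theorem exists_sum_smul_eq_sum {ι E : Type*} [Fintype ι] [Nonempty ι] [AddCommGroup E] [Module ℝ E]
    [FiniteDimensional ℝ E] (v : ι → E) :
    ∃ (e : Fin (Module.finrank ℝ E + 1) → ι) (c : Fin (Module.finrank ℝ E + 1) → ℝ),
      (∀ j, 0 ≤ c j) ∧ ∑ j, c j • v (e j) = ∑ i, v i := by
  classical
  have hN : (Fintype.card ι : ℝ) ≠ 0 := Nat.cast_ne_zero.2 Fintype.card_ne_zero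
  -- The average lies in the convex hull; the factor `Fintype.card ι` is returned to the
  -- coefficients, and unused slots get weight 0.
  have hmem : (Fintype.card ι : ℝ)⁻¹ • ∑ i, v i ∈ convexHull ℝ (Set.range v) := by
    rw [Finset.smul_sum]
    refine (convex_convexHull ℝ (Set.range v)).sum_mem (fun i _ => by positivity) ?_
      (fun i _ => subset_convexHull ℝ _ (Set.mem_range_self i))
    rw [Finset.sum_const, Finset.card_univ, nsmul_eq_mul, mul_inv_cancel₀ hN]
  obtain ⟨κ, _, z, w, hz, haff, hw, hsum, heq⟩ := eq_pos_convex_span_of_mem_convexHull hmem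
  have hcard : Fintype.card κ ≤ Fintype.card (Fin (Module.finrank ℝ E + 1)) := by
    rw [Fintype.card_fin]
    exact haff.card_le_finrank_succ.trans (by gcongr; exact Submodule.finrank_le _)
  obtain ⟨f⟩ := Function.Embedding.nonempty_of_card_le hcard
  choose g hg using fun k => hz (Set.mem_range_self k)
  obtain ⟨i₀⟩ := ‹Nonempty ι›
  refine ⟨Function.extend f g fun _ => i₀,
    Function.extend f (fun k => Fintype.card ι * w k) fun _ => 0, fun j => ?_, ?_⟩
  · by_cases h : ∃ k, f k = j
    · obtain ⟨k, rfl⟩ := h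
      rw [f.injective.extend_apply]
      exact mul_nonneg (Nat.cast_nonneg _) (hw k).le
    · rw [Function.extend_apply' _ _ _ h]
  · rw [← Finset.sum_subset (Finset.subset_univ (Finset.univ.map f)), Finset.sum_map]
    · simp only [f.injective.extend_apply, hg, mul_smul]
      rw [← Finset.smul_sum, heq, smul_inv_smul₀ hN]
    · intro j _ hj
      rw [Function.extend_apply', zero_smul]
      rintro ⟨k, rfl⟩
      simp at hj

end Caratheodory

/-! ### Conditional entropy of unnormalized measures. -/

section FiberEntropy

theorem law_smul {Ω β : Type*} [Fintype Ω] (c : ℝ) (q : Ω → ℝ) (f : Ω → β) (b : β) :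
    law (fun ω => c * q ω) f b = c * law q f b := by
  classical
  rw [law_eq_sum_ite, law_eq_sum_ite, Finset.mul_sum]
  simp

variable {Ω α β γ : Type*} [Fintype Ω] [Fintype α] [Fintype β] [Fintype γ]

/-- The conditional entropy of the first component given the second one, for a measure `m`. -/
def fiberEntropy (m : α × γ → ℝ) : ℝ :=
  entropy m (fun v => (v.1, v.2)) - entropy m Prod.snd

/-- The scalar cancels inside conditional probabilities. This homogeneity lets Carathéodory weights
be absorbed into the conditional laws. -/
theorem fiberEntropy_smul {m : α × γ → ℝ} (hm : ∀ v, 0 ≤ m v) {c : ℝ} (hc : 0 ≤ c) :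
    fiberEntropy (fun v => c * m v) = c * fiberEntropy m := by
  rw [fiberEntropy, fiberEntropy, ← condEntropy_eq (fun v => mul_nonneg hc (hm v)) Prod.fst,
    ← condEntropy_eq hm Prod.fst, condEntropy, condEntropy, mul_neg, Finset.mul_sum]
  rcases hc.eq_or_lt with rfl | h0
  · simp_rw [law_smul]
    simp
  · congr 1
    refine Finset.sum_congr rfl fun a _ => ?_
    rw [Finset.mul_sum]
    refine Finset.sum_congr rfl fun b _ => ?_
    rw [law_smul, law_smul, mul_div_mul_left _ _ h0.ne', mul_assoc]

/-- t log t is continuous also at 0, so no positivity is needed. -/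
theorem continuous_entropy (A : Ω → α) : Continuous fun q : Ω → ℝ => entropy q A := by
  classical
  unfold entropy
  refine (continuous_finsetSum _ fun a _ => ?_).neg
  have h : Continuous fun q : Ω → ℝ => law q A a := by
    simp_rw [law_eq_sum_ite]
    refine continuous_finsetSum _ fun ω _ => ?_
    split_ifs <;> fun_prop
  simp_rw [Real.logb, ← mul_div_assoc]
  exact (Real.continuous_mul_log.comp h).div_const _

theorem continuous_fiberEntropy : Continuous (fiberEntropy : (α × γ → ℝ) → ℝ) :=
  (continuous_entropy _).sub (continuous_entropy _)

/-- Conditional entropy is the sum of the conditional entropies on the fibers of a conditioning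
variable. -/
theorem condEntropy_eq_sum_fiberEntropy {q : Ω → ℝ} (hq : ∀ ω, 0 ≤ q ω) (A : Ω → α) (B : Ω → β)
    (C : Ω → γ) :
    condEntropy q A (fun ω => (B ω, C ω)) =
      ∑ b, fiberEntropy fun v : α × γ => law q (fun ω => (A ω, B ω, C ω)) (v.1, b, v.2) := by
  have h1 : ∀ b, fiberEntropy (fun v : α × γ => law q (fun ω => (A ω, B ω, C ω)) (v.1, b, v.2)) =
      -∑ a, ∑ c, law q (fun ω => (A ω, B ω, C ω)) (a, b, c) *
        Real.logb 2 (law q (fun ω => (A ω, B ω, C ω)) (a, b, c) /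
          law q (fun ω => (B ω, C ω)) (b, c)) := by
    intro b
    rw [fiberEntropy, ← condEntropy_eq (fun v => law_nonneg hq _ _) Prod.fst, condEntropy]
    congr 1
    refine Finset.sum_congr rfl fun a _ => Finset.sum_congr rfl fun c _ => ?_
    have e1 := law_id (fun v : α × γ => law q (fun ω => (A ω, B ω, C ω)) (v.1, b, v.2)) (a, c)
    have e2 : law (fun v : α × γ => law q (fun ω => (A ω, B ω, C ω)) (v.1, b, v.2)) Prod.snd c =
        law q (fun ω => (B ω, C ω)) (b, c) := by
      rw [← sum_law_fst _ Prod.fst Prod.snd, ← sum_law_fst q A (fun ω => (B ω, C ω))]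
      exact Finset.sum_congr rfl fun a _ =>
        law_id (fun v : α × γ => law q (fun ω => (A ω, B ω, C ω)) (v.1, b, v.2)) (a, c)
    simp only [Prod.mk.eta, e1, e2]
  simp_rw [h1]
  rw [condEntropy, Finset.sum_neg_distrib, Finset.sum_comm]
  rw [Fintype.sum_prod_type]
  exact congrArg _ (Finset.sum_congr rfl fun b _ => Finset.sum_comm)

end FiberEntropy

/-! ### Weighted marginals of the source. -/

section Mass

variable {X Y Z : Type*}

/-- The measure of `(Y,Z)` weighted by `a(Y)`. -/
def yzMass [Fintype X] (p : X × Y × Z → ℝ) (a : Y → ℝ) (v : Y × Z) : ℝ :=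
  ∑ x, p (x, v.1, v.2) * a v.1

/-- The measure of `(X,Z)` weighted by `a(Y)`. -/
def xzMass [Fintype Y] (p : X × Y × Z → ℝ) (a : Y → ℝ) (v : X × Z) : ℝ :=
  ∑ y, p (v.1, y, v.2) * a y

theorem yzMass_nonneg [Fintype X] {p : X × Y × Z → ℝ} (hp : ∀ v, 0 ≤ p v) {a : Y → ℝ}
    (ha : ∀ y, 0 ≤ a y) (v : Y × Z) : 0 ≤ yzMass p a v :=
  Finset.sum_nonneg fun _ _ => mul_nonneg (hp _) (ha _)

theorem xzMass_nonneg [Fintype Y] {p : X × Y × Z → ℝ} (hp : ∀ v, 0 ≤ p v) {a : Y → ℝ}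
    (ha : ∀ y, 0 ≤ a y) (v : X × Z) : 0 ≤ xzMass p a v :=
  Finset.sum_nonneg fun _ _ => mul_nonneg (hp _) (ha _)

theorem yzMass_smul [Fintype X] (p : X × Y × Z → ℝ) (a : Y → ℝ) (c : ℝ) :
    yzMass p (fun y => c * a y) = fun v => c * yzMass p a v := by
  funext v
  rw [yzMass, yzMass, Finset.mul_sum]
  exact Finset.sum_congr rfl fun _ _ => by ring

theorem xzMass_smul [Fintype Y] (p : X × Y × Z → ℝ) (a : Y → ℝ) (c : ℝ) :
    xzMass p (fun y => c * a y) = fun v => c * xzMass p a v := by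
  funext v
  rw [xzMass, xzMass, Finset.mul_sum]
  exact Finset.sum_congr rfl fun _ _ => by ring

end Mass

/-! ### Additive form of the single-letter costs. -/

section SingleLetter

variable {X Y Z Xhat : Type*} [Fintype X] [Fintype Y] [Fintype Z]

/-- The contribution of one value of `U` to `H(X|U,Z) - H(X|U,W,Z)`. -/
def rateTerm {W : Type*} [Fintype W] (p : X × Y × Z → ℝ) (a : Y → ℝ) (b : X → W → ℝ) : ℝ :=
  fiberEntropy (xzMass p a) - ∑ w, fiberEntropy fun v : X × Z => xzMass p a v * b v.1 w

/-- The contribution of one value of `(U,W)` to the expected distortion. -/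
def distortionTerm (p : X × Y × Z → ℝ) (d : X → Xhat → ℝ) (a : Y → ℝ) (b : X → ℝ)
    (g : Z → Xhat) : ℝ :=
  ∑ v : X × Z, xzMass p a v * b v.1 * d v.1 (g v.2)

variable {U W : Type*} [Fintype U] [Fintype W] {p : X × Y × Z → ℝ} {pU : Y → U → ℝ}
  {pW : X → U → W → ℝ}

theorem law_jointLaw_xyz (hU : ∀ y, pU y ∈ stdSimplex ℝ U) (hW : ∀ x u, pW x u ∈ stdSimplex ℝ W) :
    law (jointLaw p pU pW) (fun t => (t.1, t.2.1, t.2.2.1)) = p := by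
  classical
  funext ⟨x, y, z⟩
  rw [← sum_law_snd _ _ (fun t => t.2.2.2.1)]
  have h : ∀ u, law (jointLaw p pU pW) (fun t => ((t.1, t.2.1, t.2.2.1), t.2.2.2.1))
      ((x, y, z), u) = p (x, y, z) * pU y u := fun u => by
    rw [← law_jointLaw_xyzu p pU hW, law_eq_sum_ite, law_eq_sum_ite]
    refine Finset.sum_congr rfl fun ω _ => if_congr ?_ rfl rfl
    simp only [Prod.ext_iff, and_assoc]
  simp_rw [h]
  rw [← Finset.mul_sum, (hU y).2, mul_one]

/-- Writing I(U;Y|Z) as H(Y|Z) - H(Y|U,Z) leaves a constant minus a sum over u of terms in the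
column p(u|·), the shape needed for alphabet reduction and for continuity. -/
theorem condMutualInfo_helper_eq (hp : ∀ v, 0 ≤ p v) (hU : ∀ y, pU y ∈ stdSimplex ℝ U)
    (hW : ∀ x u, pW x u ∈ stdSimplex ℝ W) :
    condMutualInfo (jointLaw p pU pW)
      (fun (_, _, _, u, _) => u) (fun (_, y, _, _, _) => y) (fun (_, _, z, _, _) => z) =
    condEntropy p (fun t => t.2.1) (fun t => t.2.2) -
      ∑ u, fiberEntropy (yzMass p fun y => pU y u) := by
  classical
  have hj := jointLaw_nonneg hp hU hW
  rw [condMutualInfo_comm hj, condMutualInfo, condEntropy_eq_sum_fiberEntropy hj]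
  congr 1
  · exact condEntropy_congr_law (law_comp_eq_of_law_eq
      ((law_jointLaw_xyz hU hW).trans (funext fun t => (law_id p t).symm))
      fun t => (t.2.1, t.2.2))
  · refine Finset.sum_congr rfl fun u _ => congrArg _ (funext fun ⟨y, z⟩ => ?_)
    rw [← sum_law_fst _ (fun t => t.1), yzMass]
    refine Finset.sum_congr rfl fun x _ => ?_
    rw [← law_jointLaw_xyzu p pU hW, law_eq_sum_ite, law_eq_sum_ite]
    refine Finset.sum_congr rfl fun ω _ => if_congr ?_ rfl rfl
    simp only [Prod.ext_iff]
    tauto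

theorem condMutualInfo_encoder_eq (hp : ∀ v, 0 ≤ p v) (hU : ∀ y, pU y ∈ stdSimplex ℝ U)
    (hW : ∀ x u, pW x u ∈ stdSimplex ℝ W) :
    condMutualInfo (jointLaw p pU pW)
      (fun (x, _, _, _, _) => x) (fun (_, _, _, _, w) => w) (fun (_, _, z, u, _) => (u, z)) =
    ∑ u, rateTerm p (fun y => pU y u) (fun x => pW x u) := by
  classical
  have hj := jointLaw_nonneg hp hU hW
  have h1 : condEntropy (jointLaw p pU pW) (fun t => t.1)
      (fun t => (t.2.2.2.2, t.2.2.2.1, t.2.2.1)) =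
      condEntropy (jointLaw p pU pW) (fun t => t.1)
        (fun t => ((t.2.2.2.1, t.2.2.2.2), t.2.2.1)) := by
    rw [condEntropy_eq hj, condEntropy_eq hj]
    congr 1 <;> refine entropy_congr hj fun t t' => ?_ <;> simp only [Prod.mk.injEq] <;> tauto
  rw [condMutualInfo]
  refine (congrArg₂ _ (condEntropy_eq_sum_fiberEntropy hj _ _ _)
    (h1.trans (condEntropy_eq_sum_fiberEntropy hj _ _ _))).trans ?_
  simp_rw [rateTerm]
  rw [Finset.sum_sub_distrib]
  congr 1
  · refine Finset.sum_congr rfl fun u _ => congrArg _ (funext fun ⟨x, z⟩ => ?_)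
    rw [← sum_law_fst _ (fun t => t.2.1), xzMass]
    refine Finset.sum_congr rfl fun y _ => ?_
    rw [← law_jointLaw_xyzu p pU hW, law_eq_sum_ite, law_eq_sum_ite]
    refine Finset.sum_congr rfl fun ω _ => if_congr ?_ rfl rfl
    simp only [Prod.ext_iff]
    tauto
  · rw [Fintype.sum_prod_type]
    refine Finset.sum_congr rfl fun u _ => Finset.sum_congr rfl fun w _ =>
      congrArg _ (funext fun ⟨x, z⟩ => ?_)
    rw [xzMass, ← law_jointLaw_xzuw, law_eq_sum_ite, law_eq_sum_ite]
    refine Finset.sum_congr rfl fun ω _ => if_congr ?_ rfl rfl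
    simp only [Prod.ext_iff]
    tauto

theorem sum_jointLaw_mul_distortion (p : X × Y × Z → ℝ) (pU : Y → U → ℝ) (pW : X → U → W → ℝ)
    (d : X → Xhat → ℝ) (xhat : U → W → Z → Xhat) :
    ∑ x, ∑ y, ∑ z, ∑ u, ∑ w, jointLaw p pU pW (x, y, z, u, w) * d x (xhat u w z) =
      ∑ u, ∑ w, distortionTerm p d (fun y => pU y u) (fun x => pW x u w) (xhat u w) := by
  have h := sum_law_mul (jointLaw p pU pW) (fun t => (t.1, t.2.2.1, t.2.2.2.1, t.2.2.2.2))
    (fun v => d v.1 (xhat v.2.2.1 v.2.2.2 v.2.1))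
  simp only [Fintype.sum_prod_type] at h
  rw [← h]
  simp_rw [law_jointLaw_xzuw, distortionTerm, Fintype.sum_prod_type, xzMass]
  rw [Finset.sum_congr rfl fun x _ => Finset.sum_comm, Finset.sum_comm]
  refine Finset.sum_congr rfl fun u _ => ?_
  rw [Finset.sum_congr rfl fun x _ => Finset.sum_comm, Finset.sum_comm]

end SingleLetter

/-! ### Alphabet bounds, compactness and closedness. -/

section Closedness

variable {X Y Z Xhat : Type*} [Fintype X] [Fintype Y] [Fintype Z]

theorem mem_informationRegion_iff {p : X × Y × Z → ℝ} (hp : ∀ v, 0 ≤ p v) {d : X → Xhat → ℝ}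
    {D : ℝ} {r : ℝ × ℝ} :
    r ∈ informationRegion p d D ↔ ∃ (k l : ℕ) (pU : Y → Fin k → ℝ) (pW : X → Fin k → Fin l → ℝ)
      (xhat : Fin k → Fin l → Z → Xhat),
      (∀ y, pU y ∈ stdSimplex ℝ (Fin k)) ∧ (∀ x u, pW x u ∈ stdSimplex ℝ (Fin l)) ∧
      condEntropy p (fun t => t.2.1) (fun t => t.2.2) -
        ∑ u, fiberEntropy (yzMass p fun y => pU y u) ≤ r.2 ∧
      ∑ u, rateTerm p (fun y => pU y u) (fun x => pW x u) ≤ r.1 ∧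
      ∑ u, ∑ w, distortionTerm p d (fun y => pU y u) (fun x => pW x u w) (xhat u w) ≤ D := by
  unfold informationRegion
  simp only [Set.mem_ofPred_eq]
  constructor
  · rintro ⟨k, l, pU, pW, xhat, hU, hW, h⟩
    rw [condMutualInfo_helper_eq hp hU hW, condMutualInfo_encoder_eq hp hU hW,
      sum_jointLaw_mul_distortion] at h
    exact ⟨k, l, pU, pW, xhat, hU, hW, h⟩
  · rintro ⟨k, l, pU, pW, xhat, hU, hW, h⟩
    rw [← condMutualInfo_helper_eq hp hU hW, ← condMutualInfo_encoder_eq hp hU hW,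
      ← sum_jointLaw_mul_distortion] at h
    exact ⟨k, l, pU, pW, xhat, hU, hW, h⟩

theorem distortionTerm_smul_left (p : X × Y × Z → ℝ) (d : X → Xhat → ℝ) (a : Y → ℝ) (b : X → ℝ)
    (g : Z → Xhat) (c : ℝ) :
    distortionTerm p d (fun y => c * a y) b g = c * distortionTerm p d a b g := by
  rw [distortionTerm, distortionTerm, xzMass_smul, Finset.mul_sum]
  exact Finset.sum_congr rfl fun _ _ => by ring

theorem distortionTerm_smul_right (p : X × Y × Z → ℝ) (d : X → Xhat → ℝ) (a : Y → ℝ) (b : X → ℝ)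
    (g : Z → Xhat) (c : ℝ) :
    distortionTerm p d a (fun x => c * b x) g = c * distortionTerm p d a b g := by
  rw [distortionTerm, distortionTerm, Finset.mul_sum]
  exact Finset.sum_congr rfl fun _ _ => by ring

theorem rateTerm_smul {W : Type*} [Fintype W] {p : X × Y × Z → ℝ} (hp : ∀ v, 0 ≤ p v)
    {a : Y → ℝ} (ha : ∀ y, 0 ≤ a y) {b : X → W → ℝ} (hb : ∀ x w, 0 ≤ b x w) {c : ℝ}
    (hc : 0 ≤ c) : rateTerm p (fun y => c * a y) b = c * rateTerm p a b := by
  rw [rateTerm, rateTerm, xzMass_smul, fiberEntropy_smul (xzMass_nonneg hp ha) hc, mul_sub,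
    Finset.mul_sum]
  congr 1
  refine Finset.sum_congr rfl fun w _ => ?_
  rw [← fiberEntropy_smul (fun v => mul_nonneg (xzMass_nonneg hp ha v) (hb v.1 w)) hc]
  simp_rw [mul_assoc]

/-- Bound on the alphabet of `W`. -/
theorem exists_reduce_encoder {U W : Type*} [Fintype U] [Fintype W] [Nonempty W]
    {p : X × Y × Z → ℝ} (hp : ∀ v, 0 ≤ p v) (d : X → Xhat → ℝ) {pU : Y → U → ℝ}
    (hU : ∀ y u, 0 ≤ pU y u) {pW : X → U → W → ℝ} (hW : ∀ x u, pW x u ∈ stdSimplex ℝ W)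
    (xhat : U → W → Z → Xhat) :
    ∃ (pW' : X → U → Fin (Module.finrank ℝ ((X → ℝ) × ℝ × ℝ) + 1) → ℝ)
      (xhat' : U → Fin (Module.finrank ℝ ((X → ℝ) × ℝ × ℝ) + 1) → Z → Xhat),
      (∀ x u, pW' x u ∈ stdSimplex ℝ _) ∧
      (∀ u, rateTerm p (fun y => pU y u) (fun x => pW' x u) =
        rateTerm p (fun y => pU y u) (fun x => pW x u)) ∧
      ∀ u, ∑ w, distortionTerm p d (fun y => pU y u) (fun x => pW' x u w) (xhat' u w) =
        ∑ w, distortionTerm p d (fun y => pU y u) (fun x => pW x u w) (xhat u w) := by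
  -- For each u, Carathéodory preserves the normalizations of p(·|x,u), the contribution to
  -- H(X|U,W,Z), and the distortion. The term for H(X|U,Z) does not involve W.
  choose e c hc h using fun u => exists_sum_smul_eq_sum (E := (X → ℝ) × ℝ × ℝ) fun w : W =>
    (fun x => pW x u w,
      fiberEntropy fun v : X × Z => xzMass p (fun y => pU y u) v * pW v.1 u w,
      distortionTerm p d (fun y => pU y u) (fun x => pW x u w) (xhat u w))
  refine ⟨fun x u j => c u j * pW x u (e u j), fun u j => xhat u (e u j), fun x u => ⟨fun j =>
    mul_nonneg (hc u j) ((hW x u).1 _), ?_⟩, fun u => ?_, fun u => ?_⟩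
  · have h1 := congrFun (congrArg Prod.fst (h u)) x
    simp only [Prod.fst_sum, Finset.sum_apply, Prod.smul_fst, Pi.smul_apply, smul_eq_mul] at h1
    rw [h1, (hW x u).2]
  · have h1 := congrArg (fun t => t.2.1) (h u)
    simp only [Prod.fst_sum, Prod.snd_sum, Prod.smul_fst, Prod.smul_snd, smul_eq_mul] at h1
    rw [rateTerm, rateTerm, ← h1]
    congr 1
    refine Finset.sum_congr rfl fun j _ => ?_
    rw [← fiberEntropy_smul (fun v => mul_nonneg (xzMass_nonneg hp (fun y => hU y u) v)
      ((hW v.1 u).1 _)) (hc u j)]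
    simp_rw [mul_left_comm]
  · have h1 := congrArg (fun t => t.2.2) (h u)
    simp only [Prod.snd_sum, Prod.smul_snd, smul_eq_mul] at h1
    rw [← h1]
    exact Finset.sum_congr rfl fun j _ => distortionTerm_smul_right ..

/-- Bound on the alphabet of `U`. -/
theorem exists_reduce_helper {U W : Type*} [Fintype U] [Nonempty U] [Fintype W]
    {p : X × Y × Z → ℝ} (hp : ∀ v, 0 ≤ p v) (d : X → Xhat → ℝ) {pU : Y → U → ℝ}
    (hU : ∀ y, pU y ∈ stdSimplex ℝ U) {pW : X → U → W → ℝ} (hW : ∀ x u, pW x u ∈ stdSimplex ℝ W)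
    (xhat : U → W → Z → Xhat) :
    ∃ (pU' : Y → Fin (Module.finrank ℝ ((Y → ℝ) × ℝ × ℝ × ℝ) + 1) → ℝ)
      (pW' : X → Fin (Module.finrank ℝ ((Y → ℝ) × ℝ × ℝ × ℝ) + 1) → W → ℝ)
      (xhat' : Fin (Module.finrank ℝ ((Y → ℝ) × ℝ × ℝ × ℝ) + 1) → W → Z → Xhat),
      (∀ y, pU' y ∈ stdSimplex ℝ _) ∧ (∀ x u, pW' x u ∈ stdSimplex ℝ W) ∧
      ∑ u, fiberEntropy (yzMass p fun y => pU' y u) =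
        ∑ u, fiberEntropy (yzMass p fun y => pU y u) ∧
      ∑ u, rateTerm p (fun y => pU' y u) (fun x => pW' x u) =
        ∑ u, rateTerm p (fun y => pU y u) (fun x => pW x u) ∧
      ∑ u, ∑ w, distortionTerm p d (fun y => pU' y u) (fun x => pW' x u w) (xhat' u w) =
        ∑ u, ∑ w, distortionTerm p d (fun y => pU y u) (fun x => pW x u w) (xhat u w) := by
  -- The first component preserves ∑ p(u|y) = 1 for each y, the others H(Y|U,Z), the encoder rate
  -- and the distortion.
  obtain ⟨e, c, hc, h⟩ := exists_sum_smul_eq_sum (E := (Y → ℝ) × ℝ × ℝ × ℝ) fun u : U =>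
    (fun y => pU y u, fiberEntropy (yzMass p fun y => pU y u),
      rateTerm p (fun y => pU y u) (fun x => pW x u),
      ∑ w, distortionTerm p d (fun y => pU y u) (fun x => pW x u w) (xhat u w))
  refine ⟨fun y j => c j * pU y (e j), fun x j => pW x (e j), fun j => xhat (e j),
    fun y => ⟨fun j => mul_nonneg (hc j) ((hU y).1 _), ?_⟩, fun x j => hW x (e j), ?_, ?_, ?_⟩
  · have h1 := congrFun (congrArg Prod.fst h) y
    simp only [Prod.fst_sum, Finset.sum_apply, Prod.smul_fst, Pi.smul_apply, smul_eq_mul] at h1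
    rw [h1, (hU y).2]
  · have h1 := congrArg (fun t => t.2.1) h
    simp only [Prod.fst_sum, Prod.snd_sum, Prod.smul_fst, Prod.smul_snd, smul_eq_mul] at h1
    rw [← h1]
    refine Finset.sum_congr rfl fun j _ => ?_
    rw [yzMass_smul, fiberEntropy_smul (yzMass_nonneg hp fun y => (hU y).1 _) (hc j)]
  · have h1 := congrArg (fun t => t.2.2.1) h
    simp only [Prod.fst_sum, Prod.snd_sum, Prod.smul_fst, Prod.smul_snd, smul_eq_mul] at h1
    rw [← h1]
    exact Finset.sum_congr rfl fun j _ =>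
      rateTerm_smul hp (fun y => (hU y).1 _) (fun x => (hW x _).1) (hc j)
  · have h1 := congrArg (fun t => t.2.2.2) h
    simp only [Prod.snd_sum, Prod.smul_snd, smul_eq_mul] at h1
    rw [← h1]
    refine Finset.sum_congr rfl fun j _ => ?_
    rw [Finset.mul_sum]
    exact Finset.sum_congr rfl fun w _ => distortionTerm_smul_left ..

/-- The rates and the distortion as functions of the conditional laws. -/
def costs {U W : Type*} [Fintype U] [Fintype W] (p : X × Y × Z → ℝ) (d : X → Xhat → ℝ)
    (xhat : U → W → Z → Xhat) (θ : (Y → U → ℝ) × (X → U → W → ℝ)) : ℝ × ℝ × ℝ :=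
  (∑ u, rateTerm p (fun y => θ.1 y u) (fun x => θ.2 x u),
    condEntropy p (fun t => t.2.1) (fun t => t.2.2) -
      ∑ u, fiberEntropy (yzMass p fun y => θ.1 y u),
    ∑ u, ∑ w, distortionTerm p d (fun y => θ.1 y u) (fun x => θ.2 x u w) (xhat u w))

theorem continuous_costs {U W : Type*} [Fintype U] [Fintype W] (p : X × Y × Z → ℝ)
    (d : X → Xhat → ℝ) (xhat : U → W → Z → Xhat) : Continuous (costs p d xhat) := by
  unfold costs rateTerm distortionTerm
  have h1 : ∀ u, Continuous fun θ : (Y → U → ℝ) × (X → U → W → ℝ) =>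
      yzMass p fun y => θ.1 y u := fun u => by
    unfold yzMass; fun_prop
  have h2 : ∀ u, Continuous fun θ : (Y → U → ℝ) × (X → U → W → ℝ) =>
      xzMass p fun y => θ.1 y u := fun u => by
    unfold xzMass; fun_prop
  have h2' : ∀ u v, Continuous fun θ : (Y → U → ℝ) × (X → U → W → ℝ) =>
      xzMass p (fun y => θ.1 y u) v := fun u v => (continuous_apply v).comp (h2 u)
  refine Continuous.prodMk ?_ (Continuous.prodMk ?_ ?_)
  · refine continuous_finsetSum _ fun u _ => (continuous_fiberEntropy.comp (h2 u)).sub ?_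
    refine continuous_finsetSum _ fun w _ => continuous_fiberEntropy.comp ?_
    refine continuous_pi fun v => (h2' u v).mul ?_
    fun_prop
  · exact continuous_const.sub (continuous_finsetSum _ fun u _ =>
      continuous_fiberEntropy.comp (h1 u))
  · refine continuous_finsetSum _ fun u _ => continuous_finsetSum _ fun w _ =>
      continuous_finsetSum _ fun v _ => ((h2' u v).mul ?_).mul_const _
    fun_prop

open scoped Pointwise in
/-- The set of all `(R, R₁, D)` with `(R, R₁)` in the single-letter region at distortion `D` is
closed. -/
theorem isClosed_setOf_mem_informationRegion [Finite Xhat] {p : X × Y × Z → ℝ}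
    (hp : p ∈ stdSimplex ℝ (X × Y × Z)) (d : X → Xhat → ℝ) :
    IsClosed {v : ℝ × ℝ × ℝ | (v.1, v.2.1) ∈ informationRegion p d v.2.2} := by
  obtain ⟨⟨x₀, y₀, z₀⟩⟩ := nonempty_of_mem_stdSimplex hp
  set k := Module.finrank ℝ ((Y → ℝ) × ℝ × ℝ × ℝ) + 1
  set l := Module.finrank ℝ ((X → ℝ) × ℝ × ℝ) + 1
  let K : Set ((Y → Fin k → ℝ) × (X → Fin k → Fin l → ℝ)) :=
    (Set.univ.pi fun _ => stdSimplex ℝ (Fin k)) ×ˢ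
      (Set.univ.pi fun _ => Set.univ.pi fun _ => stdSimplex ℝ (Fin l))
  have hK : IsCompact K := (isCompact_univ_pi fun _ => isCompact_stdSimplex ℝ (Fin k)).prod
    (isCompact_univ_pi fun _ => isCompact_univ_pi fun _ => isCompact_stdSimplex ℝ (Fin l))
  have key : {v : ℝ × ℝ × ℝ | (v.1, v.2.1) ∈ informationRegion p d v.2.2} =
      ⋃ xhat : Fin k → Fin l → Z → Xhat,
        {v | ∃ θ ∈ K, costs p d xhat θ ≤ v} := by
    ext ⟨R, R₁, D⟩
    simp only [Set.mem_ofPred_eq, Set.mem_iUnion, mem_informationRegion_iff hp.1]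
    constructor
    · rintro ⟨k', l', pU, pW, xhat, hU, hW, h1, h2, h3⟩
      have := nonempty_of_mem_stdSimplex (hU y₀)
      have := nonempty_of_mem_stdSimplex (hW x₀ (Classical.arbitrary _))
      obtain ⟨pW', xhat', hW', e1, e2⟩ :=
        exists_reduce_encoder hp.1 d (fun y => (hU y).1) hW xhat
      obtain ⟨pU'', pW'', xhat'', hU'', hW'', e3, e4, e5⟩ :=
        exists_reduce_helper hp.1 d hU hW' xhat'
      refine ⟨xhat'', (pU'', pW''), ⟨fun y _ => hU'' y, fun x _ u _ => hW'' x u⟩, ?_, ?_, ?_⟩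
      · exact (e4.trans (Finset.sum_congr rfl fun u _ => e1 u)).trans_le h2
      · exact (congrArg _ e3).trans_le h1
      · exact (e5.trans (Finset.sum_congr rfl fun u _ => e2 u)).trans_le h3
    · rintro ⟨xhat, ⟨pU, pW⟩, ⟨hU, hW⟩, h1, h2, h3⟩
      exact ⟨k, l, pU, pW, xhat, fun y => hU y trivial, fun x u => hW x trivial u trivial,
        h2, h1, h3⟩
  rw [key]
  -- With the alphabets bounded, finitely many reconstruction functions remain; each contributes a
  -- compact set plus the closed positive orthant.
  refine isClosed_iUnion_of_finite fun xhat => ?_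
  have hset : {v | ∃ θ ∈ K, costs p d xhat θ ≤ v} =
      Set.image (costs p d xhat) K + Set.Ici (0 : ℝ × ℝ × ℝ) := by
    ext v
    simp only [Set.mem_ofPred_eq, Set.mem_add, Set.exists_mem_image, Set.mem_Ici]
    constructor
    · rintro ⟨θ, hθ, h⟩
      exact ⟨θ, hθ, v - costs p d xhat θ, sub_nonneg.2 h, by abel⟩
    · rintro ⟨θ, hθ, w, hw, rfl⟩
      exact ⟨θ, hθ, le_add_of_nonneg_right hw⟩
  rw [hset]
  exact isClosed_Ici.add_left_of_isCompact (hK.image (continuous_costs p d xhat))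

/-- The converse part of the coding theorem. -/
theorem operationalRegion_subset_informationRegion [Finite Xhat] {p : X × Y × Z → ℝ}
    (hp : p ∈ stdSimplex ℝ (X × Y × Z)) (hMarkov : IsMarkovYXZ p) (d : X → Xhat → ℝ) (D : ℝ) :
    operationalRegion p d D ⊆ informationRegion p d D := by
  intro r hr
  have hc := isClosed_setOf_mem_informationRegion hp d
  -- With D as a third coordinate, the approximation of the rates and the distortion slack vanish in
  -- a single limit.
  have : (r.1, r.2, D) ∈ {v : ℝ × ℝ × ℝ | (v.1, v.2.1) ∈ informationRegion p d v.2.2} := by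
    rw [← hc.closure_eq, Metric.mem_closure_iff]
    intro ε hε
    obtain ⟨r', hr', hd'⟩ := Metric.mem_closure_iff.1 hr ε hε
    refine ⟨(r'.1, r'.2, D + ε / 2), Achievable.mem_informationRegion hp hMarkov hr'
      (half_pos hε), ?_⟩
    rw [Prod.dist_eq, max_lt_iff] at hd'
    rw [Prod.dist_eq, max_lt_iff, Prod.dist_eq, max_lt_iff]
    refine ⟨hd'.1, hd'.2, ?_⟩
    rw [Real.dist_eq]
    simp only [sub_add_cancel_left, abs_neg]
    rw [abs_of_pos (half_pos hε)]
    exact half_lt_self hε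
  exact this

end Closedness

/-! ### Independent exponential clocks. -/

section Clock

open MeasureTheory

/-- The standard exponential distribution. -/
def clock : Measure ℝ :=
  (volume.restrict (Set.Ioi 0)).withDensity fun t => ENNReal.ofReal (Real.exp (-t))

theorem lintegral_Ioi_exp_neg_mul {b : ℝ} (hb : 0 < b) (a : ℝ) :
    ∫⁻ t in Set.Ioi a, ENNReal.ofReal (Real.exp (-(b * t))) =
      ENNReal.ofReal (Real.exp (-(b * a)) / b) := by
  have h : (fun t => Real.exp (-(b * t))) = fun t => Real.exp (-b * t) := by
    funext t; rw [neg_mul]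
  rw [← ofReal_integral_eq_lintegral_ofReal]
  · rw [h, integral_exp_mul_Ioi (neg_lt_zero.2 hb), neg_mul, neg_div_neg_eq]
  · rw [h]; exact integrableOn_exp_mul_Ioi (neg_lt_zero.2 hb) a
  · exact Eventually.of_forall fun t => (Real.exp_pos _).le

theorem clock_Ioi {b : ℝ} (hb : 0 ≤ b) :
    clock (Set.Ioi b) = ENNReal.ofReal (Real.exp (-b)) := by
  rw [clock, withDensity_apply _ measurableSet_Ioi, Measure.restrict_restrict measurableSet_Ioi,
    Set.Ioi_inter_Ioi, sup_of_le_left hb]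
  simpa using lintegral_Ioi_exp_neg_mul one_pos b

theorem lintegral_clock {f : ℝ → ENNReal} (hf : Measurable f) :
    ∫⁻ t, f t ∂clock = ∫⁻ t in Set.Ioi 0, ENNReal.ofReal (Real.exp (-t)) * f t := by
  rw [clock, lintegral_withDensity_eq_lintegral_mul _ (by fun_prop) hf]
  rfl

instance : IsProbabilityMeasure clock := ⟨by
  rw [clock, withDensity_apply _ MeasurableSet.univ, Measure.restrict_univ]
  simpa using lintegral_Ioi_exp_neg_mul one_pos 0⟩

variable {I : Type*} [Fintype I]

/-- Independent exponential clocks. -/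
def clocks (I : Type*) [Fintype I] : Measure (I → ℝ) :=
  Measure.pi fun _ => clock

instance : IsProbabilityMeasure (clocks I) := by
  unfold clocks; infer_instance

/-- The probability that the clock `i`, slowed down by the factors `a j`, rings first. -/
theorem clocks_real_setOf_lt [DecidableEq I] (i : I) {a : I → ℝ} (ha : ∀ j, 0 ≤ a j) :
    (clocks I).real {T | 0 < T i ∧ ∀ j ≠ i, a j * T i < T j} =
      1 / (1 + ∑ j ∈ Finset.univ.erase i, a j) := by
  set s := Finset.univ.erase i with hs
  set S : Set (I → ℝ) := {T | 0 < T i ∧ ∀ j ≠ i, a j * T i < T j} with hS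
  have hmeas : MeasurableSet S := by
    have : S = {T | 0 < T i} ∩ ⋂ j, ⋂ (_ : j ≠ i), {T | a j * T i < T j} := by
      ext T; simp [hS]
    rw [this]
    refine (measurableSet_lt (by fun_prop) (by fun_prop)).inter
      (MeasurableSet.iInter fun j => MeasurableSet.iInter fun _ =>
        measurableSet_lt (by fun_prop) (by fun_prop))
  have hsum : 0 ≤ ∑ j ∈ s, a j := Finset.sum_nonneg fun j _ => ha j
  -- Given T_i = t, each other clock outlasts a_j t with probability exp(-a_j t), independently;
  -- integrating against exp(-t) gives the result.
  have hin : ∀ t : ℝ, 0 < t →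
      (∫⋯∫⁻_s, S.indicator 1 ∂fun _ => clock) (Function.update 0 i t) =
        ENNReal.ofReal (Real.exp (-((∑ j ∈ s, a j) * t))) := by
    intro t ht
    have : ∀ y : s → ℝ, S.indicator (1 : (I → ℝ) → ENNReal)
        (Function.updateFinset (Function.update 0 i t) s y) =
        (Set.univ.pi fun j : s => Set.Ioi (a j * t)).indicator 1 y := by
      intro y
      have hmem : Function.updateFinset (Function.update (0 : I → ℝ) i t) s y ∈ S ↔
          y ∈ Set.univ.pi fun j : s => Set.Ioi (a j * t) := by
        have hi : i ∉ s := by simp [hs]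
        simp only [hS, Set.mem_ofPred_eq, Function.updateFinset, hi, dif_neg, not_false_eq_true,
          Function.update_self, ht, true_and, Set.mem_pi, Set.mem_univ, Set.mem_Ioi, forall_const,
          Subtype.forall]
        constructor
        · intro h j hj
          have := h j (Finset.ne_of_mem_erase hj)
          rwa [dif_pos hj] at this
        · intro h j hj
          have hj' : j ∈ s := Finset.mem_erase.2 ⟨hj, Finset.mem_univ j⟩
          rw [dif_pos hj']
          exact h j hj'
      by_cases h : y ∈ Set.univ.pi fun j : s => Set.Ioi (a j * t)
      · rw [Set.indicator_of_mem h, Set.indicator_of_mem (hmem.2 h)]; rfl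
      · rw [Set.indicator_of_notMem h, Set.indicator_of_notMem (fun h' => h (hmem.1 h'))]
    rw [lmarginal]
    simp_rw [this]
    rw [lintegral_indicator_one (MeasurableSet.univ_pi fun _ => measurableSet_Ioi),
      Measure.pi_pi]
    simp_rw [fun j : s => clock_Ioi (mul_nonneg (ha j) ht.le)]
    rw [← ENNReal.ofReal_prod_of_nonneg fun _ _ => (Real.exp_pos _).le, ← Real.exp_sum,
      Finset.sum_neg_distrib, Finset.sum_coe_sort s fun j => a j * t, Finset.sum_mul]
  have hmain : clocks I S = ENNReal.ofReal (1 / (1 + ∑ j ∈ s, a j)) := by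
    rw [← lintegral_indicator_one hmeas, clocks, lintegral_eq_lmarginal_univ 0,
      ← Finset.insert_erase (Finset.mem_univ i), lmarginal_insert _ (by
        exact measurable_one.indicator hmeas) (Finset.notMem_erase i _), lintegral_clock (by
        exact ((measurable_one.indicator hmeas).lmarginal _).comp (measurable_update 0))]
    have : ∀ t ∈ Set.Ioi (0 : ℝ), ENNReal.ofReal (Real.exp (-t)) *
        (∫⋯∫⁻_s, S.indicator 1 ∂fun _ => clock) (Function.update 0 i t) =
        ENNReal.ofReal (Real.exp (-((1 + ∑ j ∈ s, a j) * t))) := fun t ht => by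
      rw [hin t ht, ← ENNReal.ofReal_mul (Real.exp_pos _).le, ← Real.exp_add]
      congr 2; ring
    rw [setLIntegral_congr_fun measurableSet_Ioi this, lintegral_Ioi_exp_neg_mul (by positivity)]
    simp
  rw [Measure.real, hmain, ENNReal.toReal_ofReal (by positivity)]

end Clock

/-! ### Winners of races with prescribed speeds. -/

section Race

open MeasureTheory

variable {I : Type*}

/-- The index `i` wins the race in which index `j` runs with speed `w j`. -/
def Wins (w : I → ℝ) (T : I → ℝ) (i : I) : Prop :=
  0 < w i ∧ 0 < T i ∧ ∀ j ≠ i, w j * T i < w i * T j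

theorem Wins.unique {w T : I → ℝ} {i j : I} (hi : Wins w T i) (hj : Wins w T j) : i = j := by
  by_contra h
  exact lt_asymm (hi.2.2 j (Ne.symm h)) (hj.2.2 i h)

open Classical in
/-- The winner of the race. -/
def winner [Nonempty I] (w T : I → ℝ) : I :=
  if h : ∃ i, Wins w T i then h.choose else Classical.arbitrary I

theorem Wins.winner_eq [Nonempty I] {w T : I → ℝ} {i : I} (h : Wins w T i) : winner w T = i := by
  have h' : ∃ i, Wins w T i := ⟨i, h⟩
  rw [winner, dif_pos h']
  exact h'.choose_spec.unique h

variable [Fintype I]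

theorem measurableSet_wins (w : I → ℝ) (i : I) : MeasurableSet {T | Wins w T i} := by
  have : {T | Wins w T i} = {_T | 0 < w i} ∩ ({T | 0 < T i} ∩
      ⋂ j, ⋂ (_ : j ≠ i), {T | w j * T i < w i * T j}) := by
    ext T; simp [Wins]
  rw [this]
  exact (MeasurableSet.const _).inter ((measurableSet_lt (by fun_prop) (by fun_prop)).inter
    (MeasurableSet.iInter fun j => MeasurableSet.iInter fun _ =>
      measurableSet_lt (by fun_prop) (by fun_prop)))

/-- For w_i > 0 the slowdown factors w_j / w_i sum to (1 - w_i) / w_i over j ≠ i, so the probability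
is w_i. -/
theorem clocks_real_wins_le {w : I → ℝ} (hw : ∀ j, 0 ≤ w j) (h1 : ∑ j, w j = 1) (i : I) :
    (clocks I).real {T | Wins w T i} ≤ w i := by
  classical
  rcases (hw i).eq_or_lt with h0 | h0
  · have : {T | Wins w T i} = ∅ := by
      ext T; simp [Wins, ← h0]
    simp [this, ← h0]
  · have : {T | Wins w T i} = {T | 0 < T i ∧ ∀ j ≠ i, w j / w i * T i < T j} := by
      ext T
      simp only [Wins, h0, true_and, Set.mem_ofPred_eq]
      refine and_congr_right fun _ => forall₂_congr fun j _ => ?_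
      rw [div_mul_eq_mul_div, div_lt_iff₀' h0]
    rw [this, clocks_real_setOf_lt i fun j => div_nonneg (hw j) h0.le, ← Finset.sum_div]
    have h2 := Finset.add_sum_erase Finset.univ w (Finset.mem_univ i)
    rw [h1] at h2
    have h3 : 1 + (∑ j ∈ Finset.univ.erase i, w j) / w i = 1 / w i := by
      rw [eq_sub_of_add_eq' h2]
      field_simp
      ring
    rw [h3, one_div_one_div]

/-- A lower bound for the probability that one index wins several races with common clocks. -/
theorem le_clocks_real_forall_wins {κ : Type*} [Fintype κ] [Nonempty κ] {w : κ → I → ℝ}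
    (hw : ∀ k j, 0 ≤ w k j) (h1 : ∀ k, ∑ j, w k j ≤ 1) {i : I} (hi : ∀ k, 0 < w k i) :
    1 / ∑ k, 1 / w k i ≤ (clocks I).real {T | ∀ k, Wins (w k) T i} := by
  classical
  have ha : ∀ j, 0 ≤ ∑ k, w k j / w k i := fun j =>
    Finset.sum_nonneg fun k _ => div_nonneg (hw k j) (hi k).le
  -- Winning every race is governed by the maximum over k of the ratios, here dominated by their
  -- sum.
  have hsub : {T : I → ℝ | 0 < T i ∧ ∀ j ≠ i, (∑ k, w k j / w k i) * T i < T j} ⊆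
      {T | ∀ k, Wins (w k) T i} := by
    rintro T ⟨h0, h⟩ k
    refine ⟨hi k, h0, fun j hj => ?_⟩
    rw [← div_lt_iff₀' (hi k), ← div_mul_eq_mul_div]
    refine lt_of_le_of_lt ?_ (h j hj)
    refine mul_le_mul_of_nonneg_right ?_ h0.le
    exact Finset.single_le_sum (f := fun k => w k j / w k i)
      (fun k _ => div_nonneg (hw k j) (hi k).le) (Finset.mem_univ k)
  refine le_trans ?_ (measureReal_mono hsub)
  rw [clocks_real_setOf_lt i ha]
  refine one_div_le_one_div_of_le (by
    have := Finset.sum_nonneg fun j (_ : j ∈ Finset.univ.erase i) => ha j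
    linarith) ?_
  have h2 : 1 ≤ ∑ k, w k i / w k i := by
    simp only [fun k => div_self (hi k).ne']
    rw [Finset.sum_const, Finset.card_univ, nsmul_one]
    exact_mod_cast Fintype.card_pos
  calc 1 + ∑ j ∈ Finset.univ.erase i, ∑ k, w k j / w k i
      ≤ ∑ k, w k i / w k i + ∑ j ∈ Finset.univ.erase i, ∑ k, w k j / w k i := by gcongr
    _ = ∑ j, ∑ k, w k j / w k i := Finset.add_sum_erase Finset.univ (fun j => ∑ k, w k j / w k i)
        (Finset.mem_univ i)
    _ = ∑ k, (∑ j, w k j) / w k i := by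
        rw [Finset.sum_comm]
        simp_rw [Finset.sum_div]
    _ ≤ ∑ k, 1 / w k i := Finset.sum_le_sum fun k _ =>
        div_le_div_of_nonneg_right (h1 k) (hi k).le

end Race

/-! ### One-shot code from clock races. -/

section OneShot

open MeasureTheory

/-- Derandomization: some outcome is at least as good as the average over all outcomes. -/
theorem exists_sum_mul_le_of_events {Ω S J : Type*} [MeasurableSpace Ω] (μ : Measure Ω)
    [IsProbabilityMeasure μ] [Fintype S] [Fintype J] {P : S → ℝ} (hP : ∀ s, 0 ≤ P s)
    {E G : S → J → Set Ω} (hE : ∀ s j, MeasurableSet (E s j)) (hG : ∀ s j, MeasurableSet (G s j))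
    (hGE : ∀ s j, G s j ⊆ E s j) (hdisj : ∀ s j j' ω, ω ∈ G s j → ω ∈ G s j' → j = j')
    {loss : Ω → S → ℝ} {δ : S → J → ℝ} (hδ : ∀ s j, 0 ≤ δ s j) {dm : ℝ}
    (hgood : ∀ ω s j, ω ∈ G s j → loss ω s ≤ δ s j) (hbad : ∀ ω s, loss ω s ≤ dm) :
    ∃ ω, ∑ s, P s * loss ω s ≤
      ∑ s, P s * (∑ j, μ.real (E s j) * δ s j + dm * (1 - ∑ j, μ.real (G s j))) := by
  classical
  -- A majorant of the loss: on a good event the term of its index suffices, elsewhere `dm` is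
  -- charged. The first sum uses `E`, whose probability has a simple upper bound.
  let F : Ω → ℝ := fun ω => ∑ s, P s * (∑ j, (E s j).indicator 1 ω * δ s j +
    dm * (1 - ∑ j, (G s j).indicator 1 ω))
  have hiE : ∀ s j, Integrable ((E s j).indicator (1 : Ω → ℝ)) μ := fun s j =>
    (integrable_const (1 : ℝ)).indicator (hE s j)
  have hiG : ∀ s j, Integrable ((G s j).indicator (1 : Ω → ℝ)) μ := fun s j =>
    (integrable_const (1 : ℝ)).indicator (hG s j)
  have hi1 : ∀ s, Integrable (fun ω => ∑ j, (E s j).indicator (1 : Ω → ℝ) ω * δ s j) μ := fun s =>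
    integrable_finsetSum _ fun j _ => (hiE s j).mul_const _
  have hi2 : ∀ s, Integrable (fun ω => ∑ j, (G s j).indicator (1 : Ω → ℝ) ω) μ := fun s =>
    integrable_finsetSum _ fun j _ => hiG s j
  have hi3 : ∀ s, Integrable (fun ω => dm * (1 - ∑ j, (G s j).indicator (1 : Ω → ℝ) ω)) μ :=
    fun s => ((integrable_const _).sub (hi2 s)).const_mul _
  have hi4 : ∀ s, Integrable (fun ω => P s * (∑ j, (E s j).indicator (1 : Ω → ℝ) ω * δ s j +
      dm * (1 - ∑ j, (G s j).indicator (1 : Ω → ℝ) ω))) μ :=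
    fun s => ((hi1 s).add (hi3 s)).const_mul _
  have hF : Integrable F μ := integrable_finsetSum _ fun s _ => hi4 s
  have hint : ∫ ω, F ω ∂μ =
      ∑ s, P s * (∑ j, μ.real (E s j) * δ s j + dm * (1 - ∑ j, μ.real (G s j))) := by
    rw [integral_finsetSum _ fun s _ => hi4 s]
    refine Finset.sum_congr rfl fun s _ => ?_
    rw [integral_const_mul, integral_add (hi1 s) (hi3 s), integral_const_mul,
      integral_sub (integrable_const _) (hi2 s), integral_finsetSum _ fun j _ => hiG s j,
      integral_finsetSum _ fun j _ => (hiE s j).mul_const _]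
    simp_rw [integral_mul_const, integral_indicator_one (hE s _), integral_indicator_one (hG s _)]
    simp
  obtain ⟨ω, hω⟩ := exists_le_integral hF
  refine ⟨ω, le_trans (Finset.sum_le_sum fun s _ => mul_le_mul_of_nonneg_left ?_ (hP s))
    (hω.trans_eq hint)⟩
  have hnn : ∀ j, 0 ≤ (E s j).indicator (1 : Ω → ℝ) ω * δ s j := fun j =>
    mul_nonneg (Set.indicator_nonneg (fun _ _ => zero_le_one) _) (hδ s j)
  by_cases h : ∃ j, ω ∈ G s j
  · obtain ⟨j, hj⟩ := h
    have h1 : ∑ j', (G s j').indicator (1 : Ω → ℝ) ω = 1 := by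
      rw [Finset.sum_eq_single j]
      · simp [hj]
      · intro j' _ hne
        exact Set.indicator_of_notMem (fun h' => hne (hdisj s _ _ ω h' hj)) _
      · simp
    rw [h1, sub_self, mul_zero, add_zero]
    refine (hgood ω s j hj).trans ?_
    have := Finset.single_le_sum (fun j _ => hnn j) (Finset.mem_univ j)
    simpa [hGE s j hj] using this
  · push Not at h
    have h1 : ∑ j', (G s j').indicator (1 : Ω → ℝ) ω = 0 :=
      Finset.sum_eq_zero fun j _ => Set.indicator_of_notMem (h j) _
    rw [h1, sub_zero, mul_one]
    have := Finset.sum_nonneg fun j (_ : j ∈ Finset.univ) => hnn j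
    linarith [hbad ω s]

/-- Speeds of a race over a random codebook with `M` bins. -/
def binned {U : Type*} {M : ℕ} (w : U → ℝ) (i : U × Fin M) : ℝ := w i.1 / M

/-- Speeds of a race confined to the bin `m`. -/
def inBin {U : Type*} {M : ℕ} (w : U → ℝ) (m : Fin M) (i : U × Fin M) : ℝ :=
  if i.2 = m then w i.1 else 0

variable {U W : Type*} [Fintype U] [Fintype W] {M M₁ : ℕ}

theorem sum_binned [NeZero M] (w : U → ℝ) : ∑ i : U × Fin M, binned w i = ∑ u, w u := by
  have : (M : ℝ) ≠ 0 := NeZero.ne _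
  simp only [binned, Fintype.sum_prod_type, Finset.sum_const, Finset.card_univ, Fintype.card_fin,
    nsmul_eq_mul]
  exact Finset.sum_congr rfl fun u _ => mul_div_cancel₀ _ this

theorem sum_inBin (w : U → ℝ) (m : Fin M) : ∑ i : U × Fin M, inBin w m i = ∑ u, w u := by
  simp [inBin, Fintype.sum_prod_type]

theorem clocks_real_wins_binned_le [NeZero M] {w : U → ℝ} (hw : w ∈ stdSimplex ℝ U)
    (i : U × Fin M) : (clocks (U × Fin M)).real {T | Wins (binned w) T i} ≤ w i.1 / M :=
  clocks_real_wins_le (w := binned w) (fun _ => div_nonneg (hw.1 _) (Nat.cast_nonneg _))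
    ((sum_binned w).trans hw.2) i

theorem measurableSet_wins_and_forall {I κ : Type*} [Fintype I] [Countable κ] (w : I → ℝ)
    (w' : κ → I → ℝ) (i : I) : MeasurableSet {T | Wins w T i ∧ ∀ k, Wins (w' k) T i} := by
  have : {T | Wins w T i ∧ ∀ k, Wins (w' k) T i} =
      {T | Wins w T i} ∩ ⋂ k, {T | Wins (w' k) T i} := by
    ext T; simp
  rw [this]
  exact (measurableSet_wins _ _).inter (MeasurableSet.iInter fun k => measurableSet_wins _ _)

/-- The probability that a codeword is selected by the race over all bins and recovered by every
race in its bin. -/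
theorem le_clocks_real_wins_binned [NeZero M] {κ : Type*} [Fintype κ] {w : U → ℝ}
    (hw : w ∈ stdSimplex ℝ U) {Q : κ → U → ℝ} (hQ : ∀ k u, 0 ≤ Q k u) (hQ1 : ∀ k, ∑ u, Q k u ≤ 1)
    {i : U × Fin M} (hi : 0 < w i.1) (hQi : ∀ k, 0 < Q k i.1) :
    w i.1 / M * (1 / (1 + ∑ k, w i.1 / (M * Q k i.1))) ≤
      (clocks (U × Fin M)).real
        {T | Wins (binned w) T i ∧ ∀ k, Wins (inBin (Q k) i.2) T i} := by
  have hM : (0 : ℝ) < M := Nat.cast_pos.2 (NeZero.pos M)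
  -- `none` stands for the race over all bins, which is run jointly with the races inside the bin of
  -- `i`.
  have h := le_clocks_real_forall_wins (κ := Option κ) (i := i)
    (w := fun k => k.elim (binned w) fun k => inBin (Q k) i.2)
    (by
      rintro (_ | k) j
      · exact div_nonneg (hw.1 _) hM.le
      · simp only [Option.elim, inBin]
        split_ifs
        exacts [hQ _ _, le_rfl])
    (by
      rintro (_ | k)
      · exact ((sum_binned w).trans hw.2).le
      · exact (sum_inBin _ _).trans_le (hQ1 k))
    (by
      rintro (_ | k)
      · exact div_pos hi hM
      · simpa [inBin] using hQi k)
  rw [Fintype.sum_option] at h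
  have hset : {T : U × Fin M → ℝ | ∀ k : Option κ,
      Wins (k.elim (binned w) fun k => inBin (Q k) i.2) T i} =
      {T | Wins (binned w) T i ∧ ∀ k, Wins (inBin (Q k) i.2) T i} := by
    ext T
    simp [Option.forall]
  rw [hset] at h
  refine le_trans (le_of_eq ?_) h
  have e : ∀ k, 1 / Q k i.1 = w i.1 / (M * Q k i.1) * (M / w i.1) := fun k => by
    have := (hQi k).ne'
    field_simp
  simp only [Option.elim, inBin, if_true, binned, e, ← Finset.sum_mul, one_div_div]
  rw [← one_add_mul, one_div, one_div, mul_inv, inv_div, mul_comm]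

/-- A union bound: separates the failures to recover U at the encoder (a), U at the decoder (b) and
W at the decoder (c). -/
theorem one_sub_le_one_div_mul {a b c : ℝ} (ha : 0 ≤ a) (hb : 0 ≤ b) (hc : 0 ≤ c) :
    1 - (a / (1 + a) + b / (1 + b) + c / (1 + c)) ≤ 1 / (1 + (a + b)) * (1 / (1 + c)) := by
  have h1 : a / (1 + (a + b)) ≤ a / (1 + a) :=
    div_le_div_of_nonneg_left ha (by positivity) (by linarith)
  have h2 : b / (1 + (a + b)) ≤ b / (1 + b) :=
    div_le_div_of_nonneg_left hb (by positivity) (by linarith)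
  have e1 : 1 / (1 + (a + b)) = 1 - (a / (1 + (a + b)) + b / (1 + (a + b))) := by
    field_simp; ring
  have e2 : 1 / (1 + c) = 1 - c / (1 + c) := by
    field_simp; ring
  have h3 : 0 ≤ a / (1 + (a + b)) + b / (1 + (a + b)) := by positivity
  have h4 : 0 ≤ c / (1 + c) := by positivity
  rw [e1, e2]
  nlinarith [mul_nonneg h3 h4]

/-- One-shot coding theorem: binning over codebooks selected by races of exponential clocks. -/
theorem exists_oneShot_code {S A B C V : Type*} [Fintype S] [Nonempty U] [Nonempty W]
    [NeZero M₁] [NeZero M] {P : S → ℝ} (hP : ∀ s, 0 ≤ P s) (fx : S → A) (fy : S → B) (fz : S → C)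
    {pU : B → U → ℝ} (hU : ∀ b, pU b ∈ stdSimplex ℝ U)
    {pW : A → U → W → ℝ} (hW : ∀ a u, pW a u ∈ stdSimplex ℝ W)
    {Qx : A → U → ℝ} (hQx : ∀ a u, 0 ≤ Qx a u) (hQx1 : ∀ a, ∑ u, Qx a u ≤ 1)
    {Qz : C → U → ℝ} (hQz : ∀ c u, 0 ≤ Qz c u) (hQz1 : ∀ c, ∑ u, Qz c u ≤ 1)
    {Qw : U → C → W → ℝ} (hQw : ∀ u c w, 0 ≤ Qw u c w) (hQw1 : ∀ u c, ∑ w, Qw u c w ≤ 1)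
    (hpos : ∀ s u w, 0 < P s → 0 < pU (fy s) u → 0 < pW (fx s) u w →
      0 < Qx (fx s) u ∧ 0 < Qz (fz s) u ∧ 0 < Qw u (fz s) w)
    (xhat : U → W → C → V) {δ : A → V → ℝ} (hδ : ∀ a v, 0 ≤ δ a v) {dm : ℝ}
    (hdm0 : 0 ≤ dm) (hdm : ∀ a v, δ a v ≤ dm) :
    ∃ (h : B → Fin M₁) (e : A → Fin M₁ → Fin M) (g : C → Fin M₁ → Fin M → V),
      ∑ s, P s * δ (fx s) (g (fz s) (h (fy s)) (e (fx s) (h (fy s)))) ≤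
        ∑ s, ∑ u, ∑ w, P s * pU (fy s) u * pW (fx s) u w * (δ (fx s) (xhat u w (fz s)) +
          dm * (pU (fy s) u / (M₁ * Qx (fx s) u) / (1 + pU (fy s) u / (M₁ * Qx (fx s) u)) +
            pU (fy s) u / (M₁ * Qz (fz s) u) / (1 + pU (fy s) u / (M₁ * Qz (fz s) u)) +
            pW (fx s) u w / (M * Qw u (fz s) w) / (1 + pW (fx s) u w / (M * Qw u (fz s) w)))) := by
  let Ω := (U × Fin M₁ → ℝ) × (W × Fin M → ℝ)
  let J := (U × Fin M₁) × (W × Fin M)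
  let μ : Measure Ω := (clocks (U × Fin M₁)).prod (clocks (W × Fin M))
  -- `true` is the encoder's race for U, `false` the decoder's.
  let Q₁ : S → Bool → U → ℝ := fun s b => cond b (Qx (fx s)) (Qz (fz s))
  let Q₂ : S → U → Unit → W → ℝ := fun s u _ => Qw u (fz s)
  -- The second race uses the codeword named by `j` rather than a random winner, so each event is a
  -- product over the two clock families.
  let E : S → J → Set Ω := fun s j => {T | Wins (binned (pU (fy s))) T j.1} ×ˢ
    {T | Wins (binned (pW (fx s) j.1.1)) T j.2}
  let G : S → J → Set Ω := fun s j =>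
    {T | Wins (binned (pU (fy s))) T j.1 ∧ ∀ k, Wins (inBin (Q₁ s k) j.1.2) T j.1} ×ˢ
    {T | Wins (binned (pW (fx s) j.1.1)) T j.2 ∧ ∀ k, Wins (inBin (Q₂ s j.1.1 k) j.2.2) T j.2}
  let hlp : Ω → B → Fin M₁ := fun ω b => (winner (binned (pU b)) ω.1).2
  let uE : Ω → A → Fin M₁ → U := fun ω a m => (winner (inBin (Qx a) m) ω.1).1
  let uD : Ω → C → Fin M₁ → U := fun ω c m => (winner (inBin (Qz c) m) ω.1).1
  let enc : Ω → A → Fin M₁ → Fin M := fun ω a m => (winner (binned (pW a (uE ω a m))) ω.2).2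
  let dec : Ω → C → Fin M₁ → Fin M → V := fun ω c m m' =>
    xhat (uD ω c m) (winner (inBin (Qw (uD ω c m) c) m') ω.2).1 c
  have hE : ∀ s j, MeasurableSet (E s j) := fun s j =>
    (measurableSet_wins _ _).prod (measurableSet_wins _ _)
  have hG : ∀ s j, MeasurableSet (G s j) := fun s j =>
    (measurableSet_wins_and_forall _ _ _).prod (measurableSet_wins_and_forall _ _ _)
  obtain ⟨ω, hω⟩ := exists_sum_mul_le_of_events μ hP hE hG
    (fun s j ω h => ⟨h.1.1, h.2.1⟩)
    (fun s j j' ω h h' => by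
      have h1 : j.1 = j'.1 := h.1.1.unique h'.1.1
      have h2 := h.2.1
      rw [h1] at h2
      exact Prod.ext h1 (h2.unique h'.2.1))
    (loss := fun ω s => δ (fx s) (dec ω (fz s) (hlp ω (fy s)) (enc ω (fx s) (hlp ω (fy s)))))
    (δ := fun s j => δ (fx s) (xhat j.1.1 j.2.1 (fz s)))
    (fun _ _ => hδ _ _)
    (fun ω s j h => by
      obtain ⟨⟨h1, h2⟩, h3, h4⟩ := h
      have e1 : hlp ω (fy s) = j.1.2 := congrArg Prod.snd h1.winner_eq
      have e2 : uE ω (fx s) j.1.2 = j.1.1 := congrArg Prod.fst (h2 true).winner_eq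
      have e3 : uD ω (fz s) j.1.2 = j.1.1 := congrArg Prod.fst (h2 false).winner_eq
      have e4 : enc ω (fx s) j.1.2 = j.2.2 := by
        simp only [enc, e2]
        exact congrArg Prod.snd h3.winner_eq
      have e5 : dec ω (fz s) j.1.2 j.2.2 = xhat j.1.1 j.2.1 (fz s) := by
        simp only [dec, e3]
        rw [(h4 ()).winner_eq]
      rw [e1, e4, e5])
    (dm := dm) (fun ω s => hdm _ _)
  refine ⟨hlp ω, enc ω, dec ω, hω.trans (Finset.sum_le_sum fun s _ => ?_)⟩
  set err : U → W → ℝ := fun u w =>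
    pU (fy s) u / (M₁ * Qx (fx s) u) / (1 + pU (fy s) u / (M₁ * Qx (fx s) u)) +
      pU (fy s) u / (M₁ * Qz (fz s) u) / (1 + pU (fy s) u / (M₁ * Qz (fz s) u)) +
      pW (fx s) u w / (M * Qw u (fz s) w) / (1 + pW (fx s) u w / (M * Qw u (fz s) w)) with herr
  have hM : (0 : ℝ) < M := Nat.cast_pos.2 (NeZero.pos M)
  have hM₁ : (0 : ℝ) < M₁ := Nat.cast_pos.2 (NeZero.pos M₁)
  have hsum : ∀ c : U → W → ℝ,
      ∑ j : J, pU (fy s) j.1.1 / M₁ * (pW (fx s) j.1.1 j.2.1 / M) * c j.1.1 j.2.1 =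
        ∑ u, ∑ w, pU (fy s) u * pW (fx s) u w * c u w := by
    intro c
    simp only [J, Fintype.sum_prod_type, Finset.sum_const, Finset.card_univ, Fintype.card_fin,
      nsmul_eq_mul]
    refine Finset.sum_congr rfl fun u _ => ?_
    rw [Finset.mul_sum]
    refine Finset.sum_congr rfl fun w _ => ?_
    field_simp
  have hb1 : ∑ j, μ.real (E s j) * δ (fx s) (xhat j.1.1 j.2.1 (fz s)) ≤
      ∑ u, ∑ w, pU (fy s) u * pW (fx s) u w * δ (fx s) (xhat u w (fz s)) := by
    rw [← hsum fun u w => δ (fx s) (xhat u w (fz s))]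
    refine Finset.sum_le_sum fun j _ => mul_le_mul_of_nonneg_right ?_ (hδ _ _)
    rw [measureReal_prod_prod]
    exact mul_le_mul (clocks_real_wins_binned_le (hU _) _) (clocks_real_wins_binned_le (hW _ _) _)
      measureReal_nonneg (div_nonneg ((hU _).1 _) hM₁.le)
  have hb2 : P s * ∑ u, ∑ w, pU (fy s) u * pW (fx s) u w * (1 - err u w) ≤
      P s * ∑ j, μ.real (G s j) := by
    rcases (hP s).eq_or_lt with h0 | h0
    · simp [← h0]
    refine mul_le_mul_of_nonneg_left ?_ h0.le
    rw [← hsum fun u w => 1 - err u w]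
    refine Finset.sum_le_sum fun j _ => ?_
    rcases ((hU (fy s)).1 j.1.1).eq_or_lt with h1 | h1
    · simp [← h1]
    rcases ((hW (fx s) j.1.1).1 j.2.1).eq_or_lt with h2 | h2
    · simp [← h2]
    obtain ⟨q1, q2, q3⟩ := hpos s _ _ h0 h1 h2
    rw [measureReal_prod_prod]
    have g1 := le_clocks_real_wins_binned (hU (fy s)) (Q := Q₁ s)
      (by rintro (_ | _) <;> simp [Q₁, hQx, hQz])
      (by rintro (_ | _) <;> simp [Q₁, hQx1, hQz1]) (i := j.1) h1
      (by rintro (_ | _) <;> simpa [Q₁])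
    have g2 := le_clocks_real_wins_binned (hW (fx s) j.1.1) (Q := Q₂ s j.1.1)
      (fun _ => hQw _ _) (fun _ => hQw1 _ _) (i := j.2) h2 (fun _ => q3)
    rw [Fintype.sum_bool] at g1
    rw [Fintype.sum_unique] at g2
    refine le_trans ?_ (mul_le_mul g1 g2 (by positivity) measureReal_nonneg)
    rw [mul_mul_mul_comm]
    refine mul_le_mul_of_nonneg_left ?_ (by positivity)
    exact one_sub_le_one_div_mul (by positivity) (by positivity) (by positivity)
  have htot : ∑ u, ∑ w, pU (fy s) u * pW (fx s) u w = 1 := by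
    simp_rw [← Finset.mul_sum, (hW _ _).2, mul_one]
    exact (hU _).2
  have e1 : ∑ u, ∑ w, P s * pU (fy s) u * pW (fx s) u w *
      (δ (fx s) (xhat u w (fz s)) + dm * err u w) =
      P s * ∑ u, ∑ w, pU (fy s) u * pW (fx s) u w * δ (fx s) (xhat u w (fz s)) +
      dm * (P s - P s * ∑ u, ∑ w, pU (fy s) u * pW (fx s) u w * (1 - err u w)) := by
    have : ∑ u, ∑ w, pU (fy s) u * pW (fx s) u w * (1 - err u w) =
        1 - ∑ u, ∑ w, pU (fy s) u * pW (fx s) u w * err u w := by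
      simp only [mul_sub, mul_one, Finset.sum_sub_distrib, htot]
    rw [this]
    have e : P s - P s * (1 - ∑ u, ∑ w, pU (fy s) u * pW (fx s) u w * err u w) =
      P s * ∑ u, ∑ w, pU (fy s) u * pW (fx s) u w * err u w := by ring
    rw [e]
    simp only [Finset.mul_sum, ← Finset.sum_add_distrib]
    exact Finset.sum_congr rfl fun u _ => Finset.sum_congr rfl fun w _ => by ring
  rw [e1, mul_add]
  refine add_le_add (mul_le_mul_of_nonneg_left hb1 (hP s)) ?_
  rw [mul_left_comm]
  refine mul_le_mul_of_nonneg_left ?_ hdm0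
  linarith

end OneShot

/-! ### Exponential decay of the block error. -/

section Chernoff

open Topology

variable {Ω : Type*} [Fintype Ω]

/-- Exponential tilting: if the mean of `log₂ a` is less than `R`, then `E[a ^ s] < 2 ^ (s R)` for
some small `s > 0`. -/
theorem exists_sum_mul_rpow_lt {q : Ω → ℝ} (hq : q ∈ stdSimplex ℝ Ω) {a : Ω → ℝ}
    (ha : ∀ ω, 0 < q ω → 0 < a ω) {R : ℝ} (hR : ∑ ω, q ω * Real.logb 2 (a ω) < R) :
    ∃ s : ℝ, 0 < s ∧ s ≤ 1 ∧ ∑ ω, q ω * a ω ^ s < 2 ^ (s * R) := by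
  have hlog2 : 0 < Real.log 2 := Real.log_pos one_lt_two
  let c : Ω → ℝ := fun ω => Real.log (a ω) - R * Real.log 2
  -- The moment generating function of log a - R log 2 equals 1 at s = 0 with negative slope, so it
  -- drops below 1 for small s > 0.
  have hderiv : HasDerivAt (fun s : ℝ => ∑ ω, q ω * Real.exp (s * c ω)) (∑ ω, q ω * c ω) 0 := by
    refine HasDerivAt.fun_sum fun ω _ => ?_
    have h := (((hasDerivAt_id (0 : ℝ)).mul_const (c ω)).exp).const_mul (q ω)
    simpa using h
  have hneg : ∑ ω, q ω * c ω < 0 := by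
    have : ∑ ω, q ω * c ω = (∑ ω, q ω * Real.logb 2 (a ω) - R) * Real.log 2 := by
      simp only [c, mul_sub, Finset.sum_sub_distrib, ← Finset.sum_mul, hq.2, one_mul]
      rw [sub_mul, Finset.sum_mul]
      congr 1
      refine Finset.sum_congr rfl fun ω _ => ?_
      rw [mul_assoc, Real.logb, div_mul_cancel₀ _ hlog2.ne']
    rw [this]
    exact mul_neg_of_neg_of_pos (sub_neg.2 hR) hlog2
  have h0 : ∑ ω, q ω * Real.exp (0 * c ω) = 1 := by simpa using hq.2
  have hev : ∀ᶠ s in 𝓝[>] (0 : ℝ), ∑ ω, q ω * Real.exp (s * c ω) < 1 := by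
    have h1 := (hasDerivAt_iff_tendsto_slope.1 hderiv).mono_left
      (nhdsWithin_mono 0 (fun s (hs : 0 < s) => hs.ne') : 𝓝[>] (0 : ℝ) ≤ 𝓝[≠] 0)
    filter_upwards [h1.eventually (gt_mem_nhds hneg), self_mem_nhdsWithin] with s hs hs0
    rw [slope_def_field, h0, sub_zero] at hs
    have := (div_lt_iff₀ (show (0 : ℝ) < s from hs0)).1 hs
    linarith
  have hev2 : ∀ᶠ s in 𝓝[>] (0 : ℝ), s ≤ 1 :=
    nhdsWithin_le_nhds (Iic_mem_nhds one_pos)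
  obtain ⟨s, hs, hs1, hs0⟩ := (hev.and (hev2.and self_mem_nhdsWithin)).exists
  refine ⟨s, hs0, hs1, ?_⟩
  have e : ∑ ω, q ω * a ω ^ s = (∑ ω, q ω * Real.exp (s * c ω)) * 2 ^ (s * R) := by
    rw [Finset.sum_mul]
    refine Finset.sum_congr rfl fun ω _ => ?_
    rcases (hq.1 ω).eq_or_lt with h | h
    · simp [← h]
    · rw [Real.rpow_def_of_pos (ha ω h), Real.rpow_def_of_pos two_pos, mul_assoc, ← Real.exp_add]
      simp only [c]
      congr 2
      ring
  rw [e]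
  exact mul_lt_of_lt_one_left (by positivity) hs

/-- The left side is at most min(t, 1), and a power in (0, 1] lies above that minimum. Powers,
unlike t / (1 + t), factor over blocks. -/
theorem div_one_add_le_rpow {t s : ℝ} (ht : 0 ≤ t) (hs : 0 < s) (hs1 : s ≤ 1) :
    t / (1 + t) ≤ t ^ s := by
  rcases le_total t 1 with h | h
  · calc t / (1 + t) ≤ t := div_le_self ht (by linarith)
      _ = t ^ (1 : ℝ) := (Real.rpow_one t).symm
      _ ≤ t ^ s := Real.rpow_le_rpow_of_exponent_ge' ht h hs.le hs1
  · calc t / (1 + t) ≤ 1 := div_le_one_of_le₀ (by linarith) (by linarith)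
      _ ≤ t ^ s := Real.one_le_rpow h hs.le

theorem half_le_floor {x : ℝ} (hx : 1 ≤ x) : x / 2 ≤ ⌊x⌋₊ := by
  have h1 : (1 : ℝ) ≤ ⌊x⌋₊ := by exact_mod_cast (Nat.one_le_floor_iff x).2 hx
  have h2 := Nat.lt_floor_add_one x
  linarith

theorem sum_prod_eq_pow {n : ℕ} (f : Ω → ℝ) :
    ∑ τ : Fin n → Ω, ∏ i, f (τ i) = (∑ ω, f ω) ^ n := by
  rw [← Fintype.piFinset_univ, ← Finset.prod_univ_sum]
  simp

/-- The error term of an i.i.d. block tends to zero when the rate exceeds the mean information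
density. -/
theorem tendsto_sum_prod_mul_div {q : Ω → ℝ} (hq : q ∈ stdSimplex ℝ Ω) {a : Ω → ℝ}
    (ha0 : ∀ ω, 0 ≤ a ω) (ha : ∀ ω, 0 < q ω → 0 < a ω) {R : ℝ} (hR0 : 0 ≤ R)
    (hR : ∑ ω, q ω * Real.logb 2 (a ω) < R) :
    Tendsto (fun n : ℕ => ∑ τ : Fin n → Ω, (∏ i, q (τ i)) *
      ((∏ i, a (τ i)) / ⌊(2 : ℝ) ^ ((n : ℝ) * R)⌋₊ /
        (1 + (∏ i, a (τ i)) / ⌊(2 : ℝ) ^ ((n : ℝ) * R)⌋₊))) atTop (𝓝 0) := by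
  obtain ⟨s, hs0, hs1, hs⟩ := exists_sum_mul_rpow_lt hq ha hR
  set A := ∑ ω, q ω * a ω ^ s with hA
  have hA0 : 0 ≤ A := Finset.sum_nonneg fun ω _ => mul_nonneg (hq.1 ω) (Real.rpow_nonneg (ha0 ω) s)
  set ρ := A / 2 ^ (s * R) with hρ
  have hρ0 : 0 ≤ ρ := by positivity
  have hρ1 : ρ < 1 := (div_lt_one (by positivity)).2 hs
  have hlim : Tendsto (fun n : ℕ => 2 * ρ ^ n) atTop (𝓝 0) := by
    simpa using (tendsto_pow_atTop_nhds_zero_of_lt_one hρ0 hρ1).const_mul 2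
  have hprod0 : ∀ {n : ℕ} (τ : Fin n → Ω), 0 ≤ ∏ i, a (τ i) := fun τ =>
    Finset.prod_nonneg fun _ _ => ha0 _
  have hq0 : ∀ {n : ℕ} (τ : Fin n → Ω), 0 ≤ ∏ i, q (τ i) := fun τ =>
    Finset.prod_nonneg fun _ _ => hq.1 _
  refine squeeze_zero (fun n => Finset.sum_nonneg fun τ _ => mul_nonneg (hq0 τ) ?_)
    (fun n => ?_) hlim
  · have := hprod0 τ
    positivity
  · have hx : (1 : ℝ) ≤ 2 ^ ((n : ℝ) * R) := Real.one_le_rpow one_le_two (by positivity)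
    have hM := half_le_floor hx
    set M : ℝ := (⌊(2 : ℝ) ^ ((n : ℝ) * R)⌋₊ : ℝ)
    have hM0 : 0 < M := lt_of_lt_of_le (by positivity) hM
    calc ∑ τ : Fin n → Ω, (∏ i, q (τ i)) * ((∏ i, a (τ i)) / M / (1 + (∏ i, a (τ i)) / M))
        ≤ ∑ τ : Fin n → Ω, (∏ i, q (τ i)) * ((∏ i, a (τ i)) / M) ^ s :=
          Finset.sum_le_sum fun τ _ => mul_le_mul_of_nonneg_left
            (div_one_add_le_rpow (div_nonneg (hprod0 τ) hM0.le) hs0 hs1) (hq0 τ)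
      _ = A ^ n / M ^ s := by
          rw [hA, ← sum_prod_eq_pow, Finset.sum_div]
          refine Finset.sum_congr rfl fun τ _ => ?_
          rw [Real.div_rpow (hprod0 τ) hM0.le, ← Real.finsetProd_rpow _ _ (fun i _ => ha0 _),
            Finset.prod_mul_distrib, mul_div_assoc]
      _ ≤ A ^ n / ((2 : ℝ) ^ ((n : ℝ) * R) / 2) ^ s :=
          div_le_div_of_nonneg_left (pow_nonneg hA0 n) (by positivity)
            (Real.rpow_le_rpow (by positivity) hM hs0.le)
      _ = 2 ^ s * ρ ^ n := by
          rw [Real.div_rpow (by positivity) (by positivity), ← Real.rpow_mul two_pos.le, hρ,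
            div_pow, ← Real.rpow_natCast (2 ^ (s * R)), ← Real.rpow_mul two_pos.le,
            show (n : ℝ) * R * s = s * R * n by ring]
          field_simp
      _ ≤ 2 * ρ ^ n := by
          refine mul_le_mul_of_nonneg_right ?_ (pow_nonneg hρ0 n)
          calc (2 : ℝ) ^ s ≤ 2 ^ (1 : ℝ) := Real.rpow_le_rpow_of_exponent_le one_le_two hs1
            _ = 2 := Real.rpow_one 2

end Chernoff

/-! ### Conditional laws and Markov chains. -/

section ConditionalLaw

variable {Ω α β γ : Type*} [Fintype Ω]

/-- Conditional probabilities `P(A = a | C = c)`. -/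
def condLaw (q : Ω → ℝ) (A : Ω → α) (C : Ω → γ) (c : γ) (a : α) : ℝ :=
  law q (fun ω => (A ω, C ω)) (a, c) / law q C c

theorem condLaw_nonneg {q : Ω → ℝ} (hq : ∀ ω, 0 ≤ q ω) (A : Ω → α) (C : Ω → γ) (c : γ) (a : α) :
    0 ≤ condLaw q A C c a :=
  div_nonneg (law_nonneg hq _ _) (law_nonneg hq _ _)

/-- Only an inequality, because the sum is 0 when `c` has no mass. -/
theorem sum_condLaw_le_one [Fintype α] (q : Ω → ℝ) (A : Ω → α) (C : Ω → γ) (c : γ) :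
    ∑ a, condLaw q A C c a ≤ 1 := by
  simp_rw [condLaw]
  rw [← Finset.sum_div, sum_law_fst]
  exact div_self_le_one _

theorem condLaw_pos {q : Ω → ℝ} (hq : ∀ ω, 0 ≤ q ω) (A : Ω → α) (C : Ω → γ) {ω : Ω}
    (h : 0 < q ω) : 0 < condLaw q A C (C ω) (A ω) :=
  div_pos (law_pos_of_pos hq (fun ω => (A ω, C ω)) h) (law_pos_of_pos hq C h)

variable [Fintype α] [Fintype γ]

theorem condEntropy_eq_neg_sum_condLaw (q : Ω → ℝ) (A : Ω → α) (C : Ω → γ) :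
    condEntropy q A C = -∑ ω, q ω * Real.logb 2 (condLaw q A C (C ω) (A ω)) :=
  condEntropy_eq_sum q A C

/-- Conditional entropy computed from a conditional law. -/
theorem condEntropy_eq_of_kernel {q : Ω → ℝ} (hq : ∀ ω, 0 ≤ q ω) (A : Ω → α) (C : Ω → γ)
    {κ : γ → α → ℝ} (h : ∀ a c, law q (fun ω => (A ω, C ω)) (a, c) = law q C c * κ c a) :
    condEntropy q A C = -∑ ω, q ω * Real.logb 2 (κ (C ω) (A ω)) := by
  rw [condEntropy_eq_sum]
  congr 1
  refine Finset.sum_congr rfl fun ω _ => ?_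
  rcases (hq ω).eq_or_lt with h0 | h0
  · simp [← h0]
  · rw [h, mul_div_cancel_left₀ _ (law_pos_of_pos hq C h0).ne']

/-- If `A - C - B` is a Markov chain, then `H(A|B,C) = H(A|C)`. -/
theorem condEntropy_prod_eq_of_factorization [Fintype β] {q : Ω → ℝ} (hq : ∀ ω, 0 ≤ q ω)
    (A : Ω → α) (B : Ω → β) (C : Ω → γ) {f : β → γ → ℝ} {h : α → γ → ℝ}
    (hfac : ∀ a b c, law q (fun ω => (A ω, B ω, C ω)) (a, b, c) = f b c * h a c) :
    condEntropy q A (fun ω => (B ω, C ω)) = condEntropy q A C := by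
  classical
  rw [condEntropy_eq_sum, condEntropy_eq_sum]
  congr 1
  refine Finset.sum_congr rfl fun ω _ => ?_
  rcases (hq ω).eq_or_lt with h0 | h0
  · simp [← h0]
  have h1 : ∀ b c, law q (fun ω => (B ω, C ω)) (b, c) = f b c * ∑ a, h a c := fun b c => by
    rw [← sum_law_fst q A, Finset.mul_sum]
    exact Finset.sum_congr rfl fun a _ => hfac a b c
  have h2 : ∀ a c, law q (fun ω => (A ω, C ω)) (a, c) = (∑ b, f b c) * h a c := fun a c => by
    rw [← sum_law_fst q B, Finset.sum_mul]
    refine Finset.sum_congr rfl fun b _ => ?_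
    rw [← hfac, law_eq_sum_ite, law_eq_sum_ite]
    refine Finset.sum_congr rfl fun ω _ => if_congr ?_ rfl rfl
    simp only [Prod.mk.injEq]
    tauto
  have h3 : ∀ c, law q C c = (∑ b, f b c) * ∑ a, h a c := fun c => by
    rw [← sum_law_fst q A, Finset.mul_sum]
    exact Finset.sum_congr rfl fun a _ => h2 a c
  have p1 := (law_pos_of_pos hq (fun ω => (B ω, C ω)) h0).ne'
  have p2 := (law_pos_of_pos hq C h0).ne'
  rw [h1] at p1
  rw [h3] at p2
  rw [hfac, h1, h2, h3, mul_div_mul_left _ _ (left_ne_zero_of_mul p1),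
    mul_div_mul_left _ _ (left_ne_zero_of_mul p2)]

end ConditionalLaw

/-! ### Mean information densities. -/

section InformationDensity

theorem pos_of_jointLaw_pos {X Y Z U W : Type*} [Fintype U] [Fintype W] {p : X × Y × Z → ℝ}
    {pU : Y → U → ℝ} {pW : X → U → W → ℝ} (hU : ∀ y, pU y ∈ stdSimplex ℝ U)
    (hW : ∀ x u, pW x u ∈ stdSimplex ℝ W) {t : X × Y × Z × U × W}
    (h : 0 < jointLaw p pU pW t) : 0 < pU t.2.1 t.2.2.2.1 ∧ 0 < pW t.1 t.2.2.2.1 t.2.2.2.2 := by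
  constructor
  · refine ((hU _).1 _).lt_of_ne fun h0 => h.ne' ?_
    change p _ * pU t.2.1 t.2.2.2.1 * _ = 0
    rw [← h0, mul_zero, zero_mul]
  · refine ((hW _ _).1 _).lt_of_ne fun h0 => h.ne' ?_
    change _ * pW t.1 t.2.2.2.1 t.2.2.2.2 = 0
    rw [← h0, mul_zero]

variable {X Y Z U W : Type*} [Fintype X] [Fintype Y] [Fintype Z] [Fintype U] [Fintype W]

theorem sum_mul_logb_div {Ω : Type*} [Fintype Ω] {q a b : Ω → ℝ} (hq : ∀ ω, 0 ≤ q ω)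
    (ha : ∀ ω, 0 < q ω → 0 < a ω) (hb : ∀ ω, 0 < q ω → 0 < b ω) :
    ∑ ω, q ω * Real.logb 2 (a ω / b ω) =
      ∑ ω, q ω * Real.logb 2 (a ω) - ∑ ω, q ω * Real.logb 2 (b ω) := by
  rw [← Finset.sum_sub_distrib]
  refine Finset.sum_congr rfl fun ω _ => ?_
  rcases (hq ω).eq_or_lt with h0 | h0
  · simp [← h0]
  · rw [Real.logb_div (ha ω h0).ne' (hb ω h0).ne', mul_sub]

variable {p : X × Y × Z → ℝ} {pU : Y → U → ℝ} {pW : X → U → W → ℝ}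

theorem condEntropy_helper_eq (hp : ∀ v, 0 ≤ p v) (hU : ∀ y, pU y ∈ stdSimplex ℝ U)
    (hW : ∀ x u, pW x u ∈ stdSimplex ℝ W) :
    condEntropy (jointLaw p pU pW) (fun t => t.2.2.2.1) (fun t => (t.2.1, t.2.2.1)) =
      -∑ t, jointLaw p pU pW t * Real.logb 2 (pU t.2.1 t.2.2.2.1) := by
  classical
  refine condEntropy_eq_of_kernel (jointLaw_nonneg hp hU hW) _ _
    (κ := fun (c : Y × Z) u => pU c.1 u) ?_
  rintro u ⟨y, z⟩
  have h1 : ∀ u, law (jointLaw p pU pW) (fun t => (t.2.2.2.1, t.2.1, t.2.2.1)) (u, y, z) =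
      (∑ x, p (x, y, z)) * pU y u := fun u => by
    rw [← sum_law_fst _ (fun t => t.1), Finset.sum_mul]
    refine Finset.sum_congr rfl fun x _ => ?_
    rw [← law_jointLaw_xyzu p pU hW, law_eq_sum_ite, law_eq_sum_ite]
    refine Finset.sum_congr rfl fun ω _ => if_congr ?_ rfl rfl
    simp only [Prod.ext_iff]
    tauto
  rw [← sum_law_fst (jointLaw p pU pW) (fun t => t.2.2.2.1) (fun t => (t.2.1, t.2.2.1))]
  simp_rw [h1]
  rw [← Finset.mul_sum, (hU y).2, mul_one]

theorem condEntropy_encoder_eq (hp : ∀ v, 0 ≤ p v) (hU : ∀ y, pU y ∈ stdSimplex ℝ U)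
    (hW : ∀ x u, pW x u ∈ stdSimplex ℝ W) :
    condEntropy (jointLaw p pU pW) (fun t => t.2.2.2.2)
      (fun t => (t.1, t.2.2.2.1, t.2.2.1)) =
      -∑ t, jointLaw p pU pW t * Real.logb 2 (pW t.1 t.2.2.2.1 t.2.2.2.2) := by
  classical
  refine condEntropy_eq_of_kernel (jointLaw_nonneg hp hU hW) _ _
    (κ := fun (c : X × U × Z) w => pW c.1 c.2.1 w) ?_
  rintro w ⟨x, u, z⟩
  have h1 : ∀ w, law (jointLaw p pU pW) (fun t => (t.2.2.2.2, t.1, t.2.2.2.1, t.2.2.1))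
      (w, x, u, z) = (∑ y, p (x, y, z) * pU y u) * pW x u w := fun w => by
    rw [← law_jointLaw_xzuw, law_eq_sum_ite, law_eq_sum_ite]
    refine Finset.sum_congr rfl fun ω _ => if_congr ?_ rfl rfl
    simp only [Prod.ext_iff]
    tauto
  rw [← sum_law_fst (jointLaw p pU pW) (fun t => t.2.2.2.2)
    (fun t => (t.1, t.2.2.2.1, t.2.2.1))]
  simp_rw [h1]
  rw [← Finset.mul_sum, (hW x u).2, mul_one]

/-- The numerator p(u|y) is also the law of U given (Y,Z), so the mean is H(U|Z) - H(U|Y,Z): the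
rate at which the decoder recovers U. -/
theorem sum_helper_density_z (hp : ∀ v, 0 ≤ p v) (hU : ∀ y, pU y ∈ stdSimplex ℝ U)
    (hW : ∀ x u, pW x u ∈ stdSimplex ℝ W) :
    ∑ t, jointLaw p pU pW t * Real.logb 2 (pU t.2.1 t.2.2.2.1 /
      condLaw (jointLaw p pU pW) (fun t => t.2.2.2.1) (fun t => t.2.2.1) t.2.2.1 t.2.2.2.1) =
    condMutualInfo (jointLaw p pU pW)
      (fun (_, _, _, u, _) => u) (fun (_, y, _, _, _) => y) (fun (_, _, z, _, _) => z) := by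
  have hj := jointLaw_nonneg hp hU hW
  rw [sum_mul_logb_div hj (fun t h => (pos_of_jointLaw_pos hU hW h).1)
    (fun t h => condLaw_pos hj (fun t => t.2.2.2.1) (fun t => t.2.2.1) h)]
  have h1 := condEntropy_helper_eq hp hU hW
  have h2 := condEntropy_eq_neg_sum_condLaw (jointLaw p pU pW) (fun t => t.2.2.2.1)
    (fun t => t.2.2.1)
  change _ = condEntropy (jointLaw p pU pW) (fun t => t.2.2.2.1) (fun t => t.2.2.1) -
    condEntropy (jointLaw p pU pW) (fun t => t.2.2.2.1) (fun t => (t.2.1, t.2.2.1))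
  rw [h1, h2]
  ring

/-- Under `Y - X - Z` the encoder needs no higher helper rate than the decoder to recover `U`. -/
theorem sum_helper_density_x_le (hp : ∀ v, 0 ≤ p v) (hMarkov : IsMarkovYXZ p)
    (hU : ∀ y, pU y ∈ stdSimplex ℝ U) (hW : ∀ x u, pW x u ∈ stdSimplex ℝ W) :
    ∑ t, jointLaw p pU pW t * Real.logb 2 (pU t.2.1 t.2.2.2.1 /
      condLaw (jointLaw p pU pW) (fun t => t.2.2.2.1) (fun t => t.1) t.1 t.2.2.2.1) ≤
    condMutualInfo (jointLaw p pU pW)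
      (fun (_, _, _, u, _) => u) (fun (_, y, _, _, _) => y) (fun (_, _, z, _, _) => z) := by
  classical
  have hj := jointLaw_nonneg hp hU hW
  rw [sum_mul_logb_div hj (fun t h => (pos_of_jointLaw_pos hU hW h).1)
    (fun t h => condLaw_pos hj (fun t => t.2.2.2.1) (fun t => t.1) h)]
  have h1 := condEntropy_helper_eq hp hU hW
  have h2 := condEntropy_eq_neg_sum_condLaw (jointLaw p pU pW) (fun t => t.2.2.2.1)
    (fun t => t.1)
  -- U - X - Z holds because Y - X - Z does and U is drawn from Y.
  have h3 : condEntropy (jointLaw p pU pW) (fun t => t.2.2.2.1) (fun t => (t.2.2.1, t.1)) =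
      condEntropy (jointLaw p pU pW) (fun t => t.2.2.2.1) (fun t => t.1) := by
    refine condEntropy_prod_eq_of_factorization hj _ _ _
      (f := fun z x => law p (fun s => (s.1, s.2.2)) (x, z) / law p (fun s => s.1) x)
      (h := fun u x => ∑ y, law p (fun s => (s.1, s.2.1)) (x, y) * pU y u) fun u z x => ?_
    rw [← sum_law_fst _ (fun t => t.2.1), Finset.mul_sum]
    refine Finset.sum_congr rfl fun y _ => ?_
    rw [← mul_assoc, ← hMarkov.eq_div_mul hp, ← law_jointLaw_xyzu p pU hW, law_eq_sum_ite,
      law_eq_sum_ite]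
    refine Finset.sum_congr rfl fun ω _ => if_congr ?_ rfl rfl
    simp only [Prod.ext_iff]
    tauto
  have h4 : condEntropy (jointLaw p pU pW) (fun t => t.2.2.2.1) (fun t => (t.2.2.1, t.1)) ≤
      condEntropy (jointLaw p pU pW) (fun t => t.2.2.2.1) (fun t => t.2.2.1) := by
    refine le_of_eq_of_le ?_ (condEntropy_prod_le hj (fun t => t.2.2.2.1) (fun t => t.1)
      (fun t => t.2.2.1))
    rw [condEntropy_eq hj, condEntropy_eq hj]
    congr 1 <;> refine entropy_congr hj fun t t' => ?_ <;> simp only [Prod.mk.injEq] <;> tauto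
  change _ ≤ condEntropy (jointLaw p pU pW) (fun t => t.2.2.2.1) (fun t => t.2.2.1) -
    condEntropy (jointLaw p pU pW) (fun t => t.2.2.2.1) (fun t => (t.2.1, t.2.2.1))
  linarith

theorem sum_encoder_density (hp : ∀ v, 0 ≤ p v) (hU : ∀ y, pU y ∈ stdSimplex ℝ U)
    (hW : ∀ x u, pW x u ∈ stdSimplex ℝ W) :
    ∑ t, jointLaw p pU pW t * Real.logb 2 (pW t.1 t.2.2.2.1 t.2.2.2.2 /
      condLaw (jointLaw p pU pW) (fun t => t.2.2.2.2) (fun t => (t.2.2.2.1, t.2.2.1))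
        (t.2.2.2.1, t.2.2.1) t.2.2.2.2) =
    condMutualInfo (jointLaw p pU pW)
      (fun (x, _, _, _, _) => x) (fun (_, _, _, _, w) => w) (fun (_, _, z, u, _) => (u, z)) := by
  have hj := jointLaw_nonneg hp hU hW
  rw [sum_mul_logb_div hj (fun t h => (pos_of_jointLaw_pos hU hW h).2)
    (fun t h => condLaw_pos hj (fun t => t.2.2.2.2) (fun t => (t.2.2.2.1, t.2.2.1)) h)]
  have h1 := condEntropy_encoder_eq hp hU hW
  have h2 := condEntropy_eq_neg_sum_condLaw (jointLaw p pU pW) (fun t => t.2.2.2.2)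
    (fun t => (t.2.2.2.1, t.2.2.1))
  rw [condMutualInfo_comm hj]
  change _ = condEntropy (jointLaw p pU pW) (fun t => t.2.2.2.2)
      (fun t => (t.2.2.2.1, t.2.2.1)) -
    condEntropy (jointLaw p pU pW) (fun t => t.2.2.2.2) (fun t => (t.1, t.2.2.2.1, t.2.2.1))
  rw [h1, h2]
  ring

end InformationDensity

/-! ### Achievability for i.i.d. blocks. -/

section Achievability

variable {X Y Z Xhat : Type*} [Fintype X] [Fintype Y] [Fintype Z]

theorem sum_prod_pi {n : ℕ} {α : Type*} [Fintype α] (f : Fin n → α → ℝ) :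
    ∑ u : Fin n → α, ∏ i, f i (u i) = ∏ i, ∑ a, f i a := by
  rw [← Fintype.piFinset_univ, ← Finset.prod_univ_sum]

theorem prod_mem_stdSimplex {n : ℕ} {α : Type*} [Fintype α] {f : Fin n → α → ℝ}
    (hf : ∀ i, f i ∈ stdSimplex ℝ α) :
    (fun u : Fin n → α => ∏ i, f i (u i)) ∈ stdSimplex ℝ (Fin n → α) := by
  refine ⟨fun u => Finset.prod_nonneg fun i _ => (hf i).1 _, ?_⟩
  rw [sum_prod_pi]
  exact Finset.prod_eq_one fun i _ => (hf i).2

theorem sum_prod_pi_le_one {n : ℕ} {α : Type*} [Fintype α] {f : Fin n → α → ℝ}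
    (hf : ∀ i a, 0 ≤ f i a) (h1 : ∀ i, ∑ a, f i a ≤ 1) :
    ∑ u : Fin n → α, ∏ i, f i (u i) ≤ 1 := by
  rw [sum_prod_pi]
  exact Finset.prod_le_one (fun i _ => Finset.sum_nonneg fun a _ => hf i a) fun i _ => h1 i

/-- Sums over source blocks and auxiliary blocks as sums over blocks of tuples. -/
theorem sum_blocks {n : ℕ} {U W : Type*} [Fintype U] [Fintype W]
    (F : (Fin n → X × Y × Z) → (Fin n → U) → (Fin n → W) → ℝ) :
    ∑ s, ∑ u, ∑ w, F s u w =
      ∑ τ : Fin n → X × Y × Z × U × W, F (fun i => ((τ i).1, (τ i).2.1, (τ i).2.2.1))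
        (fun i => (τ i).2.2.2.1) (fun i => (τ i).2.2.2.2) := by
  let e : (Fin n → X × Y × Z × U × W) ≃ (Fin n → X × Y × Z) × (Fin n → U) × (Fin n → W) :=
    { toFun := fun τ => (fun i => ((τ i).1, (τ i).2.1, (τ i).2.2.1), fun i => (τ i).2.2.2.1,
        fun i => (τ i).2.2.2.2)
      invFun := fun v i => ((v.1 i).1, (v.1 i).2.1, (v.1 i).2.2, v.2.1 i, v.2.2 i)
      left_inv := fun _ => rfl
      right_inv := fun _ => rfl }
  have h := Equiv.sum_comp e fun v => F v.1 v.2.1 v.2.2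
  rw [Fintype.sum_prod_type] at h
  simp only [Fintype.sum_prod_type] at h
  exact h.symm

theorem jointLaw_mem_stdSimplex {U W : Type*} [Fintype U] [Fintype W] {p : X × Y × Z → ℝ}
    (hp : p ∈ stdSimplex ℝ (X × Y × Z)) {pU : Y → U → ℝ} {pW : X → U → W → ℝ}
    (hU : ∀ y, pU y ∈ stdSimplex ℝ U) (hW : ∀ x u, pW x u ∈ stdSimplex ℝ W) :
    jointLaw p pU pW ∈ stdSimplex ℝ (X × Y × Z × U × W) := by
  refine ⟨jointLaw_nonneg hp.1 hU hW, ?_⟩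
  rw [← sum_law (jointLaw p pU pW) (fun t => (t.1, t.2.1, t.2.2.1)), law_jointLaw_xyz hU hW]
  exact hp.2

/-- Rates strictly above the single-letter bounds are achievable. -/
theorem achievable_of_lt [Finite Xhat] {p : X × Y × Z → ℝ} (hp : p ∈ stdSimplex ℝ (X × Y × Z))
    (hMarkov : IsMarkovYXZ p) {d : X → Xhat → ℝ} (hd : ∀ x xh, 0 ≤ d x xh) {D : ℝ} {r : ℝ × ℝ}
    {k l : ℕ} {pU : Y → Fin k → ℝ} {pW : X → Fin k → Fin l → ℝ}
    (xhat : Fin k → Fin l → Z → Xhat)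
    (hU : ∀ y, pU y ∈ stdSimplex ℝ (Fin k)) (hW : ∀ x u, pW x u ∈ stdSimplex ℝ (Fin l))
    (hR₁ : condMutualInfo (jointLaw p pU pW)
      (fun (_, _, _, u, _) => u) (fun (_, y, _, _, _) => y) (fun (_, _, z, _, _) => z) < r.2)
    (hR : condMutualInfo (jointLaw p pU pW)
      (fun (x, _, _, _, _) => x) (fun (_, _, _, _, w) => w) (fun (_, _, z, u, _) => (u, z))
        < r.1)
    (hD : ∑ t, jointLaw p pU pW t * d t.1 (xhat t.2.2.2.1 t.2.2.2.2 t.2.2.1) ≤ D) :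
    Achievable p d D r := by
  intro ε hε
  obtain ⟨⟨x₀, y₀, z₀⟩⟩ := nonempty_of_mem_stdSimplex hp
  have hkne := nonempty_of_mem_stdSimplex (hU y₀)
  have hlne := nonempty_of_mem_stdSimplex (hW x₀ (Classical.arbitrary _))
  have hj := jointLaw_nonneg hp.1 hU hW
  have hjs := jointLaw_mem_stdSimplex hp hU hW
  -- Positive rates make both message sets nonempty.
  have hR₁0 : 0 < r.2 := (condMutualInfo_nonneg hj _ _ _).trans_lt hR₁
  have hR0 : 0 < r.1 := (condMutualInfo_nonneg hj _ _ _).trans_lt hR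
  obtain ⟨C, hC⟩ := (Set.finite_range fun v : X × Xhat => d v.1 v.2).bddAbove
  have hdC : ∀ x xh, d x xh ≤ max C 0 := fun x xh =>
    (hC (Set.mem_range_self (x, xh))).trans (le_max_left _ _)
  set dm := max C 0
  have hdm0 : 0 ≤ dm := le_max_right _ _
  set j := jointLaw p pU pW with hjdef
  -- The races are rerun with the true posteriors; on blocks their products are used, so the
  -- likelihood ratios factor over time.
  let Qx : X → Fin k → ℝ := condLaw j (fun t => t.2.2.2.1) (fun t => t.1)
  let Qz : Z → Fin k → ℝ := condLaw j (fun t => t.2.2.2.1) (fun t => t.2.2.1)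
  let Qw : Fin k → Z → Fin l → ℝ := fun u z =>
    condLaw j (fun t => t.2.2.2.2) (fun t => (t.2.2.2.1, t.2.2.1)) (u, z)
  have hQpos : ∀ t, 0 < j t → 0 < Qx t.1 t.2.2.2.1 ∧ 0 < Qz t.2.2.1 t.2.2.2.1 ∧
      0 < Qw t.2.2.2.1 t.2.2.1 t.2.2.2.2 := fun t h =>
    ⟨condLaw_pos hj (fun t => t.2.2.2.1) (fun t => t.1) h,
      condLaw_pos hj (fun t => t.2.2.2.1) (fun t => t.2.2.1) h,
      condLaw_pos hj (fun t => t.2.2.2.2) (fun t => (t.2.2.2.1, t.2.2.1)) h⟩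
  have hQx0 : ∀ x u, 0 ≤ Qx x u := fun x u => condLaw_nonneg hj _ _ _ _
  have hQz0 : ∀ z u, 0 ≤ Qz z u := fun z u => condLaw_nonneg hj _ _ _ _
  have hQw0 : ∀ u z w, 0 ≤ Qw u z w := fun u z w => condLaw_nonneg hj _ _ _ _
  let ax : X × Y × Z × Fin k × Fin l → ℝ := fun t => pU t.2.1 t.2.2.2.1 / Qx t.1 t.2.2.2.1
  let az : X × Y × Z × Fin k × Fin l → ℝ := fun t => pU t.2.1 t.2.2.2.1 / Qz t.2.2.1 t.2.2.2.1
  let aw : X × Y × Z × Fin k × Fin l → ℝ := fun t =>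
    pW t.1 t.2.2.2.1 t.2.2.2.2 / Qw t.2.2.2.1 t.2.2.1 t.2.2.2.2
  have lx := tendsto_sum_prod_mul_div hjs (a := ax)
    (fun t => div_nonneg ((hU _).1 _) (hQx0 _ _))
    (fun t h => div_pos (pos_of_jointLaw_pos hU hW h).1 (hQpos t h).1) hR₁0.le
    ((sum_helper_density_x_le hp.1 hMarkov hU hW).trans_lt hR₁)
  have lz := tendsto_sum_prod_mul_div hjs (a := az)
    (fun t => div_nonneg ((hU _).1 _) (hQz0 _ _))
    (fun t h => div_pos (pos_of_jointLaw_pos hU hW h).1 (hQpos t h).2.1) hR₁0.le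
    ((sum_helper_density_z hp.1 hU hW).trans_lt hR₁)
  have lw := tendsto_sum_prod_mul_div hjs (a := aw)
    (fun t => div_nonneg ((hW _ _).1 _) (hQw0 _ _ _))
    (fun t h => div_pos (pos_of_jointLaw_pos hU hW h).2 (hQpos t h).2.2) hR0.le
    ((sum_encoder_density hp.1 hU hW).trans_lt hR)
  have ltot := ((lx.add lz).add lw).const_mul dm
  rw [add_zero, add_zero, mul_zero] at ltot
  filter_upwards [ltot.eventually (gt_mem_nhds hε), eventually_gt_atTop 0] with n hn hn0
  have hn0' : (0 : ℝ) < n := Nat.cast_pos.2 hn0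
  have hfloor : ∀ {R : ℝ}, 0 < R → ⌊(2 : ℝ) ^ ((n : ℝ) * R)⌋₊ ≠ 0 := fun {R} h =>
    (Nat.floor_pos.2 (Real.one_le_rpow one_le_two (by positivity))).ne'
  set M₁ := ⌊(2 : ℝ) ^ ((n : ℝ) * r.2)⌋₊ with hM₁def
  set M := ⌊(2 : ℝ) ^ ((n : ℝ) * r.1)⌋₊ with hMdef
  have : NeZero M₁ := ⟨hfloor hR₁0⟩
  have : NeZero M := ⟨hfloor hR0⟩
  obtain ⟨h, e, g, hcode⟩ := exists_oneShot_code (M₁ := M₁) (M := M)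
    (U := Fin n → Fin k) (W := Fin n → Fin l)
    (P := fun s : Fin n → X × Y × Z => ∏ i, p (s i)) (prod_nonneg_of_mem hp)
    (fun s i => (s i).1) (fun s i => (s i).2.1) (fun s i => (s i).2.2)
    (pU := fun y u => ∏ i, pU (y i) (u i)) (fun y => prod_mem_stdSimplex fun i => hU (y i))
    (pW := fun x u w => ∏ i, pW (x i) (u i) (w i))
    (fun x u => prod_mem_stdSimplex fun i => hW (x i) (u i))
    (Qx := fun x u => ∏ i, Qx (x i) (u i)) (fun x u => Finset.prod_nonneg fun i _ => hQx0 _ _)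
    (fun x => sum_prod_pi_le_one (fun i => hQx0 _) fun i => sum_condLaw_le_one _ _ _ _)
    (Qz := fun z u => ∏ i, Qz (z i) (u i)) (fun x u => Finset.prod_nonneg fun i _ => hQz0 _ _)
    (fun z => sum_prod_pi_le_one (fun i => hQz0 _) fun i => sum_condLaw_le_one _ _ _ _)
    (Qw := fun u z w => ∏ i, Qw (u i) (z i) (w i))
    (fun u z w => Finset.prod_nonneg fun i _ => hQw0 _ _ _)
    (fun u z => sum_prod_pi_le_one (fun i => hQw0 _ _) fun i => sum_condLaw_le_one _ _ _ _)
    (fun s u w h1 h2 h3 => by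
      have hpos : ∀ i, 0 < j ((s i).1, (s i).2.1, (s i).2.2, u i, w i) := fun i => by
        have g1 := (hp.1 (s i)).lt_of_ne' (Finset.prod_ne_zero_iff.1 h1.ne' i (Finset.mem_univ i))
        have g2 := ((hU (s i).2.1).1 (u i)).lt_of_ne'
          (Finset.prod_ne_zero_iff.1 h2.ne' i (Finset.mem_univ i))
        have g3 := ((hW (s i).1 (u i)).1 (w i)).lt_of_ne'
          (Finset.prod_ne_zero_iff.1 h3.ne' i (Finset.mem_univ i))
        exact mul_pos (mul_pos g1 g2) g3
      exact ⟨Finset.prod_pos fun i _ => (hQpos _ (hpos i)).1,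
        Finset.prod_pos fun i _ => (hQpos _ (hpos i)).2.1,
        Finset.prod_pos fun i _ => (hQpos _ (hpos i)).2.2⟩)
    (fun u w z i => xhat (u i) (w i) (z i))
    (δ := fun x v => (1 / (n : ℝ)) * ∑ i, d (x i) (v i))
    (fun x v => mul_nonneg (by positivity) (Finset.sum_nonneg fun i _ => hd _ _))
    (dm := dm) hdm0
    (fun x v => by
      have : ∑ i, d (x i) (v i) ≤ n * dm := by
        refine (Finset.sum_le_sum fun i _ => hdC (x i) (v i)).trans_eq ?_
        simp
      rw [one_div, inv_mul_le_iff₀ hn0']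
      exact this)
  refine ⟨⟨h, e, g⟩, hcode.trans ?_⟩
  rw [sum_blocks]
  have hterm : ∀ τ : Fin n → X × Y × Z × Fin k × Fin l,
      (∏ i, p ((τ i).1, (τ i).2.1, (τ i).2.2.1)) * (∏ i, pU (τ i).2.1 (τ i).2.2.2.1) *
        (∏ i, pW (τ i).1 (τ i).2.2.2.1 (τ i).2.2.2.2) = ∏ i, j (τ i) := fun τ => by
    rw [← Finset.prod_mul_distrib, ← Finset.prod_mul_distrib]
    rfl
  have hratio : ∀ (a b : Fin n → ℝ) (m : ℕ),
      (∏ i, a i) / (m * ∏ i, b i) = (∏ i, a i / b i) / m := fun a b m => by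
    rw [Finset.prod_div_distrib, div_mul_eq_div_div_swap]
  simp only [hterm, hratio]
  simp only [mul_add, Finset.sum_add_distrib]
  have hdist : ∑ τ : Fin n → X × Y × Z × Fin k × Fin l, (∏ i, j (τ i)) * ((1 / (n : ℝ)) *
      ∑ i, d (τ i).1 (xhat (τ i).2.2.2.1 (τ i).2.2.2.2 (τ i).2.2.1)) ≤ D := by
    refine le_of_eq_of_le ?_ hD
    simp_rw [mul_left_comm _ (1 / (n : ℝ)), Finset.mul_sum]
    rw [Finset.sum_comm]
    simp_rw [← Finset.mul_sum]
    simp_rw [fun i : Fin n => sum_prod_mul_eval hjs.2 i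
      (fun t => d t.1 (xhat t.2.2.2.1 t.2.2.2.2 t.2.2.1))]
    rw [Finset.sum_const, Finset.card_univ, Fintype.card_fin, nsmul_eq_mul]
    field_simp
  refine add_le_add hdist ?_
  refine le_of_eq_of_le ?_ hn.le
  simp only [mul_left_comm _ dm, ← Finset.mul_sum]
  rw [mul_add, mul_add]

/-- The direct part of the coding theorem. -/
theorem informationRegion_subset_operationalRegion [Finite Xhat] {p : X × Y × Z → ℝ}
    (hp : p ∈ stdSimplex ℝ (X × Y × Z)) (hMarkov : IsMarkovYXZ p) {d : X → Xhat → ℝ}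
    (hd : ∀ x xh, 0 ≤ d x xh) (D : ℝ) :
    informationRegion p d D ⊆ operationalRegion p d D := by
  rintro r ⟨k, l, pU, pW, xhat, hU, hW, hR₁, hR, hD⟩
  refine Metric.mem_closure_iff.2 fun ε hε => ?_
  -- Raising both rates gives strict inequalities while staying within ε in the sup metric.
  refine ⟨(r.1 + ε / 2, r.2 + ε / 2), achievable_of_lt hp hMarkov hd xhat hU hW
    (hR₁.trans_lt (lt_add_of_pos_right _ (half_pos hε)))
    (hR.trans_lt (lt_add_of_pos_right _ (half_pos hε))) ?_, ?_⟩
  · simpa only [Fintype.sum_prod_type] using hD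
  · have h : |ε / 2| < ε := by rw [abs_of_pos (half_pos hε)]; exact half_lt_self hε
    rw [Prod.dist_eq, max_lt_iff, Real.dist_eq, Real.dist_eq]
    simpa only [sub_add_cancel_left, abs_neg] using ⟨h, h⟩

end Achievability

end

end WynerZivHelper

theorem theorem2 {X Y Z Xhat : Type*} [Fintype X] [Fintype Y] [Fintype Z] [Finite Xhat]
    (p : X × Y × Z → ℝ) (hp : p ∈ stdSimplex ℝ (X × Y × Z))
    (hMarkov : WynerZivHelper.IsMarkovYXZ p)
    (d : X → Xhat → ℝ) (hd : ∀ x xh, 0 ≤ d x xh) (D : ℝ) :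
    WynerZivHelper.operationalRegion p d D = WynerZivHelper.informationRegion p d D := by
  exact Set.Subset.antisymm
    (WynerZivHelper.operationalRegion_subset_informationRegion hp hMarkov d D)
    (WynerZivHelper.informationRegion_subset_operationalRegion hp hMarkov hd D)
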